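/- Let $L$ be a first-order language extending the language of ordered rings and let $T$ be the complete $L$-theory of an o-minimal expansion of an ordered field. Assume that $T$ is exponential, i.e. some $L$-formula without parameters defines, in every model $M$ of $T$, an isomorphism of ordered groups from $(M,+)$ onto $(M^{>0},\cdot)$. Let $\mathbb E \prec \mathbb E\langle x\rangle$ be an elementary extension of models of $T$ of $\mathrm{dcl}$-dimension one generated by $x$, i.e. $x \notin \mathrm{dcl}(\mathbb E)$ and $\mathbb E\langle x\rangle = \mathrm{dcl}(\mathbb E\cup\{x\})$. A map $\partial:\mathbb E\langle x\rangle\to\mathbb E\langle x\rangle$ is a $T$-derivation if $\partial(f(u))=\sum_{i=1}^n \frac{\partial f}{\partial x_i}(u)\,\partial u_i$ for every $n$, every $\emptyset$-definable $C^1$ function $f:U\to\mathbb E\langle x\rangle$ with $U\subseteq \mathbb E\langle x\rangle^n$ open, and every $u\in U$. Let $\partial_x$ be the (only) $\mathbb E$-linear $T$-derivation on $\mathbb E\langle x\rangle$ with $\partial_x x=1$, and let $\dagger_x(z)=\partial_x z/z$ for $z\neq 0$. For a function $f:X\to Y$ into an ordered set $Y$, a subset $S\subseteq X$ is called $f$-convex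 if $f(S)$ is order-convex in $f(X)$, i.e. if $a\in X$ and $f(s)\le f(a)\le f(t)$ with $s,t\in S$ imply $f(a)\in f(S)$. Then for all $y\in\mathbb E\langle x\rangle$ with $y\ne 0$: (1) the interval $[-y,y]=\{z: -y\le z\le y\}$ is $\partial_x$-convex; (2) the interval $[1/y,y]=\{z: 1/y\le z\le y\}$ is $\dagger_x$-convex, where $\dagger_x$ is regarded as a function on $\mathbb E\langle x\rangle^{\neq 0}$. (Intervals $[a,b]$ with $a>b$ are empty.) Consequently $\partial_x$ is order-Liouville-convex, that is, both order-convex ($[-y,y]$ is $\partial_x$-convex for all $y\ge 0$) and logarithmically order-convex ($[1/y,y]$ is $\dagger_x$-convex for all $y\ge 1$). -/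

import Mathlib

open FirstOrder FirstOrder.Language Set Filter Topology

universe u v w w'

namespace OMin

section Languages

/-- A language with distinguished symbols `+, *, -, 0, 1, ≤`, i.e. a first-order language that
extends (by way of a language map) the language of ordered rings. -/
class OrderedRingLanguage (L : FirstOrder.Language.{u, v}) extends FirstOrder.Language.IsOrdered L where
  ringHom : FirstOrder.Language.ring →ᴸ L

/-- `M` is an expansion of an ordered field: the distinguished symbols of `L` are interpreted in `M`
by the field operations and by the order of the ordered field `M`. -/
class OrderedFieldExpansion (L : FirstOrder.Language.{u, v}) [OrderedRingLanguage L] (M : Type w)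
    [Field M] [LinearOrder M] [IsStrictOrderedRing M] [L.Structure M] : Prop
    extends FirstOrder.Language.OrderedStructure L M where
  funMap_add : ∀ x : Fin 2 → M,
    Structure.funMap ((OrderedRingLanguage.ringHom (L := L)).onFunction Ring.addFunc) x = x 0 + x 1
  funMap_mul : ∀ x : Fin 2 → M,
    Structure.funMap ((OrderedRingLanguage.ringHom (L := L)).onFunction Ring.mulFunc) x = x 0 * x 1
  funMap_neg : ∀ x : Fin 1 → M,
    Structure.funMap ((OrderedRingLanguage.ringHom (L := L)).onFunction Ring.negFunc) x = - x 0
  funMap_zero : ∀ x : Fin 0 → M,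
    Structure.funMap ((OrderedRingLanguage.ringHom (L := L)).onFunction Ring.zeroFunc) x = 0
  funMap_one : ∀ x : Fin 0 → M,
    Structure.funMap ((OrderedRingLanguage.ringHom (L := L)).onFunction Ring.oneFunc) x = 1

end Languages

section Theories

/-- A point, or an open interval with endpoints in `M ∪ {-∞, +∞}`. -/
def IsPointOrInterval {M : Type w} [LinearOrder M] (I : Set M) : Prop :=
  (∃ a, I = {a}) ∨ (∃ a b, I = Ioo a b) ∨ (∃ a, I = Iio a) ∨ (∃ a, I = Ioi a) ∨ I = univ

/-- The structure `M` is o-minimal: every subset of `M` that is definable with parameters is a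
finite union of points and open intervals. -/
def IsOMinimal (L : FirstOrder.Language.{u, v}) (M : Type w) [LinearOrder M] [L.Structure M] : Prop :=
  ∀ S : Set M, (univ : Set M).Definable₁ L S →
    ∃ F : Set (Set M), F.Finite ∧ (∀ I ∈ F, IsPointOrInterval I) ∧ S = ⋃₀ F

/-- `T` is (an axiomatization of) the complete theory of an o-minimal expansion of an ordered
field. -/
def IsOMinimalFieldTheory {L : FirstOrder.Language.{u, v}} [OrderedRingLanguage L] (T : L.Theory) : Prop :=
  T.IsComplete ∧
    ∃ (M : Type w) (_ : Field M) (_ : LinearOrder M) (_ : IsStrictOrderedRing M)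
      (_ : L.Structure M) (_ : OrderedFieldExpansion L M), M ⊨ T ∧ IsOMinimal L M

/-- The formula `φ(a, b)` defines in `M` the graph of an exponential, that is, of an isomorphism of
ordered groups from `(M, +)` onto `(M^{>0}, *)`. -/
def DefinesExponential {L : FirstOrder.Language.{u, v}} (φ : L.Formula (Fin 2)) (M : Type w)
    [Field M] [LinearOrder M] [L.Structure M] : Prop :=
  ∃ e : M → M, (∀ a b, φ.Realize ![a, b] ↔ b = e a) ∧
    StrictMono e ∧ (∀ a b, e (a + b) = e a * e b) ∧ range e = Ioi 0

/-- `T` is exponential: some parameter-free formula defines an exponential in every model. -/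
def IsExponentialTheory {L : FirstOrder.Language.{u, v}} [OrderedRingLanguage L] (T : L.Theory) : Prop :=
  ∃ φ : L.Formula (Fin 2), ∀ (M : Type w) [Field M] [LinearOrder M] [IsStrictOrderedRing M]
    [L.Structure M] [OrderedFieldExpansion L M], M ⊨ T → DefinesExponential φ M

end Theories

section Extensions

/-- The definable closure of `A` in `M`. -/
def dcl (L : FirstOrder.Language.{u, v}) {M : Type w} [L.Structure M] (A : Set M) : Set M :=
  {b | A.Definable₁ L {b}}

/-- `K = E⟨x⟩` is an extension of `E` of `dcl`-dimension one: `{x}` is a `dcl`-basis of `K` over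
`E`. -/
structure IsSimpleExtension {L : FirstOrder.Language.{u, v}} {K : Type w} [L.Structure K]
    (E : L.ElementarySubstructure K) (x : K) : Prop where
  notMem_dcl : x ∉ dcl L (E : Set K)
  dcl_eq_univ : dcl L (insert x (E : Set K)) = univ

end Extensions

section Derivations

variable {K : Type w} [Field K] [LinearOrder K] [TopologicalSpace K]

/-- `d` is the `i`-th partial derivative of `f` at `p`, in the sense of the ordered field `K` (which
is meant to carry its order topology). -/
def HasPartialDerivAt {n : ℕ} (f : (Fin n → K) → K) (i : Fin n) (d : K) (p : Fin n → K) : Prop :=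
  Tendsto (fun h : K => (f (Function.update p i (p i + h)) - f p) / h) (𝓝[≠] 0) (𝓝 d)

/-- On the (open) set `U` the function `f` is continuously differentiable, with partial derivatives
`f' i`. -/
def IsC1OnWith {n : ℕ} (f : (Fin n → K) → K) (f' : Fin n → (Fin n → K) → K)
    (U : Set (Fin n → K)) : Prop :=
  ∀ i, (∀ p ∈ U, HasPartialDerivAt f i (f' i p) p) ∧ ContinuousOn (f' i) U

/-- The restriction of `f` to `U` is a function `U → K` definable without parameters. -/
def IsZeroDefinableOn (L : FirstOrder.Language.{u, v}) [L.Structure K] {n : ℕ} (f : (Fin n → K) → K)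
    (U : Set (Fin n → K)) : Prop :=
  (∅ : Set K).Definable L
    {q : Fin (n + 1) → K | Fin.init q ∈ U ∧ q (Fin.last n) = f (Fin.init q)}

/-- `δ` is a `T`-derivation on the model `K` of `T`: it obeys the chain rule
`δ (f p) = ∑ i, (∂f/∂xᵢ)(p) δ(pᵢ)` for all continuously differentiable functions `f` on open
subsets `U ⊆ K ^ n` that are definable without parameters. -/
def IsTDerivation (L : FirstOrder.Language.{u, v}) [L.Structure K] (δ : K → K) : Prop :=
  ∀ (n : ℕ) (U : Set (Fin n → K)) (f : (Fin n → K) → K) (f' : Fin n → (Fin n → K) → K),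
    IsOpen U → IsZeroDefinableOn L f U → IsC1OnWith f f' U →
      ∀ p ∈ U, δ (f p) = ∑ i, f' i p * δ (p i)

/-- `δ` is linear over the subfield with underlying set `E`. -/
def IsLinearOver {K : Type w} [Field K] (E : Set K) (δ : K → K) : Prop :=
  (∀ a b, δ (a + b) = δ a + δ b) ∧ ∀ c ∈ E, ∀ a, δ (c * a) = c * δ a

end Derivations

section Convexity

/-- The convex hull of a subset of a preorder. -/
def preorderHull {Y : Type*} [Preorder Y] (S : Set Y) : Set Y :=
  {y | ∃ s ∈ S, ∃ t ∈ S, s ≤ y ∧ y ≤ t}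

/-- `S` is `f`-convex: the image `f '' S` is convex in the range of `f`. -/
def IsConvexFor {X Y : Type*} [Preorder Y] (f : X → Y) (S : Set X) : Prop :=
  ∀ x, f x ∉ f '' S → f x ∉ preorderHull (f '' S)

variable {K : Type w} [Field K]

/-- The logarithmic derivative `z ↦ δ z / z` on the nonzero elements. -/
def logDer (δ : K → K) (z : {z : K // z ≠ 0}) : K := δ z / z

variable [LinearOrder K]

/-- The interval `[a, b]`, as a subset of the nonzero elements. -/
def intervalNe (a b : K) : Set {z : K // z ≠ 0} := {z | a ≤ (z : K) ∧ (z : K) ≤ b}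

def IsOrderConvex (δ : K → K) : Prop :=
  ∀ y : K, 0 ≤ y → IsConvexFor δ (Icc (-y) y)

def IsLogOrderConvex (δ : K → K) : Prop :=
  ∀ y : K, 1 ≤ y → IsConvexFor (logDer δ) (intervalNe (1 / y) y)

def IsOrderLiouvilleConvex (δ : K → K) : Prop :=
  IsOrderConvex δ ∧ IsLogOrderConvex δ

end Convexity

end OMin

/-!
Every `z` in `E⟨x⟩` is `f(x)` for an `E`-definable function `f : K → K` which is differentiable at
`x` with `f'(x) = δ z` (`IsTDerivation.exists_hasD`). The proof rests on one consequence: if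
`δ u ≤ 0 ≤ δ v`, then some element of `E` lies between `u` and `v`
(`IsTDerivation.exists_mem_between`). For if `u = G(x)` and `v = H(x)`, then `G' ≤ 0 ≤ H'` holds on
an interval `C` around `x` that is definable over `E`, because `x ∉ dcl E` and boundary points of
`E`-definable sets are in `dcl E = E`; shrinking `C`, the sign of `H - G` is constant on `C` as
well. As `G` is antitone and `H` is monotone on `C`, the sets `G(C)` and `H(C)` are separated by the
supremum of the lower one, and this supremum is definable over `E`.

If now `δ s ≤ δ a ≤ δ t`, this applies to `u = s - a` and `v = t - a` and gives `e ∈ E` such that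
`a + e` lies between `s` and `t`; since `δ` vanishes on `E`, `δ (a + e) = δ a`. This is the convexity
for `δ`. The definable exponential is differentiable somewhere, so by its functional equation it
satisfies `exp' = l exp` with a constant `l > 0`, and the chain rule gives
`δ (exp α) / exp α = l δ α`. So the convexity for the logarithmic derivative on positive elements is
the convexity for `δ` on their logarithms, and `z ↦ -z` takes care of the negative ones.

O-minimality enters through `Tame`: definable completeness and finiteness of the boundaries of
definable sets, with the consequences that definable functions of one variable are piecewise
monotone (`Tame.exists_monotone`) and differentiable at some point of each interval
(`Tame.exists_hasD`). To represent `z` as above, write `z = F(x, e)` with `F` definable without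
parameters and `e` a tuple from `E` of minimal length; then the entries of `(x, e)` are independent
(`IsSimpleExtension.exists_indep`), and at an independent tuple definable functions are `C¹`
(`Tame.near_isC1At`), so that the chain rule for `δ` applies to `F`.

The hypotheses give o-minimality only for some model of `T`. It passes to `K` because completeness
and finiteness are first-order for each formula once the finite sets in a definable family are known
to be bounded in size (`Tame.uniformlyFinite`); for families with one parameter this is a statement
about the plane, proved with normal points (`IsNormal`), near which the set looks like the graph of
a continuous function.

Definability is handled by the classes `DefP` and `DefF`, so that instance search proves that a
predicate or function written with definable ingredients is definable.
-/

set_option linter.unusedSectionVars false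
set_option synthInstance.maxSize 1000000
set_option synthInstance.maxHeartbeats 400000
set_option linter.unusedVariables false

namespace OMin

/-! ### Definable predicates and functions -/

/-- A type of tuples over `M`, coded by the functions from a finite type to `M`. These are the
contexts in which definability is considered: `M` itself, products, and spaces `Fin n → M`. -/
class TupleSpace (M : Type w) (X : Type w) where
  ι : Type
  fin : Finite ι
  enc : X ≃ (ι → M)

attribute [instance] TupleSpace.fin

instance (M : Type w) : TupleSpace M M where
  ι := Unit
  fin := inferInstance
  enc := (Equiv.funUnique Unit M).symm

instance (M : Type w) (n : ℕ) : TupleSpace M (Fin n → M) where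
  ι := Fin n
  fin := inferInstance
  enc := Equiv.refl _

instance (M X Y : Type w) [TupleSpace M X] [TupleSpace M Y] : TupleSpace M (X × Y) where
  ι := TupleSpace.ι M X ⊕ TupleSpace.ι M Y
  fin := inferInstance
  enc := ((TupleSpace.enc (M := M)).prodCongr (TupleSpace.enc (M := M))).trans
    (Equiv.sumArrowEquivProdArrow _ _ M).symm

section Def

variable (L : FirstOrder.Language.{u, v}) {M : Type w} [L.Structure M] (A : Set M)
variable {X Y Z : Type w} [TupleSpace M X] [TupleSpace M Y] [TupleSpace M Z]

/-- The predicate `P` on tuples is definable with parameters from `A`. -/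
class DefP (P : X → Prop) : Prop where
  out : A.Definable L {v : TupleSpace.ι M X → M | P (TupleSpace.enc.symm v)}

/-- The map `f` between spaces of tuples has an `A`-definable graph. -/
class DefF (f : X → Y) : Prop where
  out : DefP L A (fun z : X × Y => z.2 = f z.1)

/-- The coordinates of the tuple `c` may be used as parameters from `A`. -/
class Param (c : X) : Prop where
  mem : ∀ i, TupleSpace.enc (M := M) c i ∈ A

variable {L A}

theorem DefP.congr {P Q : X → Prop} (h : DefP L A P) (hPQ : ∀ x, P x ↔ Q x) : DefP L A Q := by
  have : P = Q := funext fun x => propext (hPQ x)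
  exact this ▸ h

theorem DefP.mono {B : Set M} {P : X → Prop} (h : DefP L A P) (hAB : A ⊆ B) : DefP L B P :=
  ⟨h.out.mono hAB⟩

theorem DefF.mono {B : Set M} {f : X → Y} (h : DefF L A f) (hAB : A ⊆ B) : DefF L B f :=
  ⟨h.out.mono hAB⟩

instance Param.univ (c : X) : Param (Set.univ : Set M) c := ⟨fun _ => trivial⟩

theorem Param.of_mem {c : M} (hc : c ∈ A) : Param A c := ⟨fun _ => hc⟩

/-- Definability is stable under re-indexing of the coordinates. -/
theorem DefP.reindex {P : X → Prop} (h : DefP L A P) (g : Y → X)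
    (σ : TupleSpace.ι M X → TupleSpace.ι M Y)
    (hg : ∀ y i, TupleSpace.enc (g y) i = TupleSpace.enc (M := M) y (σ i)) :
    DefP L A (fun y => P (g y)) := by
  refine ⟨?_⟩
  have := h.out.preimage_comp σ
  convert this using 1
  ext v
  simp only [mem_ofPred_eq, mem_preimage]
  have : g (TupleSpace.enc.symm v) = TupleSpace.enc.symm (v ∘ σ) := by
    rw [Equiv.eq_symm_apply]
    funext i
    simp [hg]
  rw [this]

instance DefP.and {P Q : X → Prop} [h1 : DefP L A P] [h2 : DefP L A Q] :
    DefP L A (fun x => P x ∧ Q x) := ⟨h1.out.inter h2.out⟩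

instance DefP.or {P Q : X → Prop} [h1 : DefP L A P] [h2 : DefP L A Q] :
    DefP L A (fun x => P x ∨ Q x) := ⟨h1.out.union h2.out⟩

instance DefP.not {P : X → Prop} [h1 : DefP L A P] :
    DefP L A (fun x => ¬ P x) := ⟨h1.out.compl⟩

instance DefP.imp {P Q : X → Prop} [DefP L A P] [DefP L A Q] :
    DefP L A (fun x => P x → Q x) :=
  DefP.congr (P := fun x => ¬ P x ∨ Q x) inferInstance (fun x => by tauto)

instance DefP.iff {P Q : X → Prop} [DefP L A P] [DefP L A Q] :
    DefP L A (fun x => P x ↔ Q x) :=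
  DefP.congr (P := fun x => (P x → Q x) ∧ (Q x → P x)) inferInstance (fun x => by tauto)

instance DefP.const (p : Prop) : DefP L A (fun _ : X => p) := by
  by_cases h : p
  · simp only [h]; exact ⟨definable_univ⟩
  · simp only [h]; exact ⟨definable_empty⟩

instance DefP.ex {P : X → Y → Prop} [h : DefP L A (fun z : X × Y => P z.1 z.2)] :
    DefP L A (fun x => ∃ y, P x y) := by
  refine ⟨?_⟩
  have := h.out.image_comp (Sum.inl : TupleSpace.ι M X → TupleSpace.ι M X ⊕ TupleSpace.ι M Y)
  convert this using 1
  ext v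
  simp only [mem_ofPred_eq, mem_image]
  constructor
  · rintro ⟨y, hy⟩
    refine ⟨Sum.elim v (TupleSpace.enc y), ?_, by ext; simp⟩
    simpa [TupleSpace.enc, Equiv.symm_trans_apply, Equiv.sumArrowEquivProdArrow] using hy
  · rintro ⟨z, hz, rfl⟩
    exact ⟨_, hz⟩

instance DefP.all {P : X → Y → Prop} [DefP L A (fun z : X × Y => P z.1 z.2)] :
    DefP L A (fun x => ∀ y, P x y) :=
  DefP.congr (P := fun x => ¬ ∃ y, ¬ P x y) inferInstance (fun x => by simp)

instance DefP.all_index {κ : Type} [Finite κ] {P : X → κ → Prop} [h : ∀ i, DefP L A (fun x => P x i)] :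
    DefP L A (fun x => ∀ i, P x i) := by
  refine ⟨?_⟩
  have := definable_iInter_of_finite (fun i => (h i).out)
  convert this using 1
  ext v
  simp

theorem DefP.coord_eq (i j : TupleSpace.ι M X) :
    DefP L A (fun x : X => TupleSpace.enc (M := M) x i = TupleSpace.enc x j) := by
  refine ⟨⟨Term.equal (Term.var i) (Term.var j), ?_⟩⟩
  ext v
  simp

theorem DefF.of_coord (f : X → Y) (σ : TupleSpace.ι M Y → TupleSpace.ι M X)
    (hf : ∀ x i, TupleSpace.enc (f x) i = TupleSpace.enc (M := M) x (σ i)) : DefF L A f := by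
  refine ⟨DefP.congr (P := fun z : X × Y => ∀ i : TupleSpace.ι M Y,
    TupleSpace.enc (M := M) z (Sum.inr i) = TupleSpace.enc z (Sum.inl (σ i)))
      (@DefP.all_index _ _ _ _ _ _ _ _ _ fun i => DefP.coord_eq _ _) ?_⟩
  intro z
  rw [← (TupleSpace.enc (M := M)).injective.eq_iff, funext_iff]
  refine forall_congr' fun i => ?_
  rw [hf]
  rfl

instance DefF.id : DefF L A (fun x : X => x) := DefF.of_coord _ (fun i => i) (fun _ _ => rfl)

theorem DefP.comp {P : Y → Prop} (hP : DefP L A P) {f : X → Y} (hf : DefF L A f) :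
    DefP L A (fun x => P (f x)) := by
  have h1 := hf.out
  have h2 : DefP L A (fun z : X × Y => P z.2) := hP.reindex _ Sum.inr (fun _ _ => rfl)
  exact DefP.congr (P := fun x => ∃ y, y = f x ∧ P y) inferInstance (fun x => by simp)

theorem DefF.comp {g : Y → Z} (hg : DefF L A g) {f : X → Y} (hf : DefF L A f) :
    DefF L A (fun x => g (f x)) := by
  have h1 : DefP L A (fun z : (X × Z) × Y => z.2 = f z.1.1) :=
    hf.out.reindex (fun z : (X × Z) × Y => (z.1.1, z.2)) (Sum.map Sum.inl fun i => i)
      (by rintro ⟨⟨x, z⟩, y⟩ (i | i) <;> rfl)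
  have h2 : DefP L A (fun z : (X × Z) × Y => z.1.2 = g z.2) :=
    hg.out.reindex (fun z : (X × Z) × Y => (z.2, z.1.2))
      (Sum.elim Sum.inr (fun i => Sum.inl (Sum.inr i)))
      (by rintro ⟨⟨x, z⟩, y⟩ (i | i) <;> rfl)
  exact ⟨DefP.congr (P := fun z : X × Z => ∃ y, y = f z.1 ∧ z.2 = g y) inferInstance
    (fun x => by simp)⟩

instance DefF.fst {f : X → Y × Z} [hf : DefF L A f] : DefF L A (fun x => (f x).1) :=
  DefF.comp (g := Prod.fst) (DefF.of_coord _ Sum.inl (fun _ _ => rfl)) hf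

instance DefF.snd {f : X → Y × Z} [hf : DefF L A f] : DefF L A (fun x => (f x).2) :=
  DefF.comp (g := Prod.snd) (DefF.of_coord _ Sum.inr (fun _ _ => rfl)) hf

instance DefF.apply {n : ℕ} {f : X → Fin n → M} [hf : DefF L A f] (i : Fin n) :
    DefF L A (fun x => f x i) :=
  DefF.comp (g := fun v : Fin n → M => v i) (DefF.of_coord _ (fun _ => i) (fun _ _ => rfl)) hf

instance DefF.prodMk {f : X → Y} {g : X → Z} [hf : DefF L A f] [hg : DefF L A g] :
    DefF L A (fun x => (f x, g x)) := by
  have h1 : DefP L A (fun z : X × Y × Z => z.2.1 = f z.1) :=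
    hf.out.comp (f := fun z : X × Y × Z => (z.1, z.2.1))
      (DefF.of_coord _ (Sum.map (fun i => i) Sum.inl) (by rintro ⟨x, y, z⟩ (i | i) <;> rfl))
  have h2 : DefP L A (fun z : X × Y × Z => z.2.2 = g z.1) :=
    hg.out.comp (f := fun z : X × Y × Z => (z.1, z.2.2))
      (DefF.of_coord _ (Sum.map (fun i => i) Sum.inr) (by rintro ⟨x, y, z⟩ (i | i) <;> rfl))
  exact ⟨DefP.congr (P := fun z : X × Y × Z => z.2.1 = f z.1 ∧ z.2.2 = g z.1) inferInstance
    (fun z => by rw [Prod.ext_iff])⟩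

instance DefP.eq {f g : X → Y} [hf : DefF L A f] [DefF L A g] :
    DefP L A (fun x => f x = g x) :=
  DefP.comp (DefF.id (L := L) (A := A) (X := Y)).out (f := fun x => (g x, f x)) inferInstance

theorem DefF.pi {n : ℕ} {f : X → Fin n → M} (h : ∀ i, DefF L A (fun x => f x i)) :
    DefF L A f := by
  have h1 : ∀ i, DefF L A (fun z : X × (Fin n → M) => f z.1 i) := fun i => (h i).comp DefF.fst
  exact ⟨DefP.congr (P := fun z : X × (Fin n → M) => ∀ i, z.2 i = f z.1 i) inferInstance
    (fun z => by rw [funext_iff])⟩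

instance DefF.cons {n : ℕ} {a : X → M} {f : X → Fin n → M} [ha : DefF L A a] [hf : DefF L A f] :
    DefF L A (fun x => (Fin.cons (a x) (f x) : Fin (n + 1) → M)) :=
  DefF.pi (Fin.cases (by simpa using ha) (fun i => by simpa using DefF.apply i))

instance DefF.update {n : ℕ} {a : X → M} {f : X → Fin n → M} [ha : DefF L A a] [hf : DefF L A f]
    (i : Fin n) : DefF L A (fun x => Function.update (f x) i (a x)) :=
  DefF.pi fun j => by
    by_cases h : j = i
    · subst h; simpa using ha
    · simpa [h] using DefF.apply j

instance DefF.const (c : Y) [hc : Param A c] : DefF L A (fun _ : X => c) := by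
  refine ⟨DefP.congr (P := fun z : X × Y => ∀ i : TupleSpace.ι M Y,
    TupleSpace.enc (M := M) z (Sum.inr i) = TupleSpace.enc c i)
      (@DefP.all_index _ _ _ _ _ _ _ _ _ fun i => ?_) ?_⟩
  · refine ⟨⟨Term.equal (Term.var (Sum.inr i))
      (Constants.term (L.con (⟨_, hc.mem i⟩ : A))), ?_⟩⟩
    ext v
    simp only [mem_ofPred_eq, Formula.realize_equal, Term.realize_var, Term.realize_constants,
      coe_con, Equiv.apply_symm_apply]
  · intro z
    rw [← (TupleSpace.enc (M := M)).injective.eq_iff, funext_iff]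
    rfl

/-- A function whose graph is described by a definable predicate is definable. -/
theorem DefF.of_graph {f : X → Y} {P : X → Y → Prop} (h : DefP L A (fun z : X × Y => P z.1 z.2))
    (hP : ∀ x y, P x y ↔ y = f x) : DefF L A f :=
  ⟨h.congr fun z => hP _ _⟩

/-! Composition with an arbitrary definable function has low priority, so that the structural
instances for logical connectives, quantifiers and arithmetic are tried before it. -/

instance (priority := 50) DefF.comp₁ {f : Y → Z} {g : X → Y} [hf : DefF L A f] [hg : DefF L A g] :
    DefF L A (fun x => f (g x)) := hf.comp hg

instance (priority := 50) DefP.comp₁ {f : Y → Prop} {g : X → Y} [hf : DefP L A f]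
    [hg : DefF L A g] : DefP L A (fun x => f (g x)) := hf.comp hg

instance (priority := 40) DefP.comp₂ {P : Y → Z → Prop} {f : X → Y} {g : X → Z}
    [hP : DefP L A (fun z : Y × Z => P z.1 z.2)] [hf : DefF L A f]
    [hg : DefF L A g] : DefP L A (fun x => P (f x) (g x)) :=
  hP.comp (f := fun x => (f x, g x)) inferInstance

instance (priority := 40) DefF.comp₂ {W : Type w} [TupleSpace M W] {P : Y → Z → W} {f : X → Y}
    {g : X → Z} [hP : DefF L A (fun z : Y × Z => P z.1 z.2)] [hf : DefF L A f]
    [hg : DefF L A g] : DefF L A (fun x => P (f x) (g x)) :=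
  hP.comp (f := fun x => (f x, g x)) inferInstance

instance DefF.mk_left (y : Y) [hy : Param A y] : DefF L A (Prod.mk y : X → Y × X) :=
  DefF.prodMk (f := fun _ => y) (g := fun x => x)

instance (priority := 30) DefP.section {P : Y → X → Prop} (y : Y)
    [hP : DefP L A (fun z : Y × X => P z.1 z.2)] [hy : Param A y] : DefP L A (fun x => P y x) :=
  hP.comp (f := fun x => (y, x)) inferInstance

instance (priority := 30) DefF.section {F : Y → X → Z} (y : Y)
    [hP : DefF L A (fun z : Y × X => F z.1 z.2)] [hy : Param A y] :
    DefF L A (fun x => F y x) :=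
  hP.comp (f := fun x => (y, x)) inferInstance

end Def

section Ordered

variable {L : FirstOrder.Language.{u, v}} {M : Type w} [L.Structure M] {A : Set M}
variable {X Y : Type w} [TupleSpace M X] [TupleSpace M Y]

instance DefP.le [L.IsOrdered] [LinearOrder M] [L.OrderedStructure M] {f g : X → M}
    [hf : DefF L A f] [hg : DefF L A g] : DefP L A (fun x => f x ≤ g x) := by
  have : DefP L A (fun z : M × M => z.1 ≤ z.2) := by
    refine ⟨Set.Definable.mono (A := ∅) (empty_definable_iff.2
      ⟨Relations.formula₂ leSymb (Term.var (Sum.inl ())) (Term.var (Sum.inr ())), ?_⟩)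
      (empty_subset _)⟩
    ext v
    simp only [mem_ofPred_eq, Formula.realize_rel₂, relMap_leSymb, Term.realize_var]
    rfl
  exact this.comp (f := fun x => (f x, g x)) inferInstance

instance DefP.lt [L.IsOrdered] [LinearOrder M] [L.OrderedStructure M] {f g : X → M}
    [hf : DefF L A f] [hg : DefF L A g] : DefP L A (fun x => f x < g x) :=
  DefP.congr (P := fun x => ¬ g x ≤ f x) inferInstance (fun x => not_le)

variable [OrderedRingLanguage L] [Field M] [LinearOrder M] [IsStrictOrderedRing M]
  [OrderedFieldExpansion L M]

/-- Applying a function symbol of the language preserves definability. -/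
theorem DefF.fun_symbol {n : ℕ} (s : L.Functions n) (f : Fin n → X → M)
    (hf : ∀ i, DefF L A (f i)) : DefF L A (fun x => Structure.funMap s (fun i => f i x)) := by
  have : DefF L A (fun v : Fin n → M => Structure.funMap s v) := by
    refine ⟨⟨Set.Definable.mono (A := ∅) (empty_definable_iff.2
      ⟨Term.equal (Term.var (Sum.inr ())) (Term.func s fun i => Term.var (Sum.inl i)), ?_⟩)
      (empty_subset _)⟩⟩
    ext v
    simp only [mem_ofPred_eq, Formula.realize_equal, Term.realize_var, Term.realize_func]
    rfl
  exact this.comp (DefF.pi hf)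

instance DefF.add {f g : X → M} [hf : DefF L A f] [hg : DefF L A g] :
    DefF L A (fun x => f x + g x) := by
  have := DefF.fun_symbol ((OrderedRingLanguage.ringHom (L := L)).onFunction Ring.addFunc) ![f, g]
    (A := A) (by simp [Fin.forall_fin_two, hf, hg])
  simpa [OrderedFieldExpansion.funMap_add] using this

instance DefF.mul {f g : X → M} [hf : DefF L A f] [hg : DefF L A g] :
    DefF L A (fun x => f x * g x) := by
  have := DefF.fun_symbol ((OrderedRingLanguage.ringHom (L := L)).onFunction Ring.mulFunc) ![f, g]
    (A := A) (by simp [Fin.forall_fin_two, hf, hg])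
  simpa [OrderedFieldExpansion.funMap_mul] using this

instance DefF.neg {f : X → M} [hf : DefF L A f] : DefF L A (fun x => - f x) := by
  have := DefF.fun_symbol ((OrderedRingLanguage.ringHom (L := L)).onFunction Ring.negFunc) ![f]
    (A := A) (by simp [hf])
  simpa [OrderedFieldExpansion.funMap_neg] using this

instance DefF.zero : DefF L A (fun _ : X => (0 : M)) := by
  have := DefF.fun_symbol ((OrderedRingLanguage.ringHom (L := L)).onFunction Ring.zeroFunc) ![]
    (A := A) (X := X) (by simp)
  simpa [OrderedFieldExpansion.funMap_zero] using this

instance DefF.one : DefF L A (fun _ : X => (1 : M)) := by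
  have := DefF.fun_symbol ((OrderedRingLanguage.ringHom (L := L)).onFunction Ring.oneFunc) ![]
    (A := A) (X := X) (by simp)
  simpa [OrderedFieldExpansion.funMap_one] using this

instance DefF.sub {f g : X → M} [hf : DefF L A f] [hg : DefF L A g] :
    DefF L A (fun x => f x - g x) := by
  simp only [sub_eq_add_neg]; infer_instance

instance DefF.abs {f : X → M} [hf : DefF L A f] : DefF L A (fun x => |f x|) := by
  refine DefF.of_graph (P := fun x y => (0 ≤ f x ∧ y = f x) ∨ (f x ≤ 0 ∧ y = - f x))
    inferInstance fun x y => ?_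
  rcases le_total 0 (f x) with h | h
  · rw [abs_of_nonneg h]
    constructor
    · rintro (⟨_, h⟩ | ⟨h', h''⟩)
      · exact h
      · rw [h'', le_antisymm h' h, neg_zero]
    · exact fun h' => Or.inl ⟨h, h'⟩
  · rw [abs_of_nonpos h]
    constructor
    · rintro (⟨h', h''⟩ | ⟨h', h''⟩)
      · rw [h'', le_antisymm h h', neg_zero]
      · exact h''
    · exact fun h' => Or.inr ⟨h, h'⟩

open Classical in
/-- The element described by the predicate `P`, or `0` if there is no unique such element. -/
noncomputable def the (P : M → Prop) : M := if h : ∃! y, P y then h.choose else 0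

theorem the_eq {P : M → Prop} {y : M} (hy : P y) (hu : ∀ y', P y' → y' = y) : the P = y := by
  have h : ∃! y, P y := ⟨y, hy, hu⟩
  rw [the, dif_pos h]
  exact hu _ h.choose_spec.1

instance DefF.the {P : X → M → Prop} [DefP L A (fun z : X × M => P z.1 z.2)] :
    DefF L A (fun x => OMin.the (P x)) := by
  refine DefF.of_graph (P := fun x y => (P x y ∧ ∀ y', P x y' → y' = y) ∨
    ((¬ ∃ y', P x y' ∧ ∀ y'', P x y'' → y'' = y') ∧ y = 0)) inferInstance fun x y => ?_
  by_cases h : ∃ y', P x y' ∧ ∀ y'', P x y'' → y'' = y'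
  · obtain ⟨y', h1, h2⟩ := h
    rw [the_eq h1 h2]
    constructor
    · rintro (⟨h3, _⟩ | ⟨h3, _⟩)
      · exact h2 _ h3
      · exact absurd ⟨y', h1, h2⟩ h3
    · rintro rfl
      exact Or.inl ⟨h1, h2⟩
  · have : OMin.the (P x) = 0 := dif_neg h
    rw [this]
    constructor
    · rintro (⟨h3, h4⟩ | ⟨_, h3⟩)
      · exact absurd ⟨y, h3, h4⟩ h
      · exact h3
    · exact fun h3 => Or.inr ⟨h, h3⟩

end Ordered

/-! ### Definably complete structures with finite boundaries -/

section Tame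

/-- Every interval around `t` meets both `P` and its complement. -/
def IsBdry {M : Type w} [LT M] (P : M → Prop) (t : M) : Prop :=
  ∀ u w, u < t → t < w → (∃ s, u < s ∧ s < w ∧ P s) ∧ (∃ s, u < s ∧ s < w ∧ ¬ P s)

/-- The form of o-minimality that is used below: definable completeness, and finiteness of the
boundary of every definable subset of the line. -/
structure Tame (L : FirstOrder.Language.{u, v}) (M : Type w) [LinearOrder M] [L.Structure M] :
    Prop where
  exists_isLUB : ∀ P : M → Prop, DefP L (univ : Set M) P → (∃ t, P t) → (∃ u, ∀ t, P t → t ≤ u) →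
    ∃ s, (∀ t, P t → t ≤ s) ∧ ∀ u, (∀ t, P t → t ≤ u) → s ≤ u
  finite_bdry : ∀ P : M → Prop, DefP L (univ : Set M) P → {t | IsBdry P t}.Finite

variable {L : FirstOrder.Language.{u, v}} {M : Type w} [L.Structure M]
  [OrderedRingLanguage L] [Field M] [LinearOrder M] [IsStrictOrderedRing M]
  [OrderedFieldExpansion L M]

theorem definable₁_of_defP {A : Set M} {P : M → Prop} (h : DefP L A P) :
    A.Definable₁ L {t | P t} :=
  h.out.preimage_comp (β := Fin 1) (fun _ => (0 : Fin 1))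

theorem defP_of_definable₁ {A : Set M} {S : Set M} (h : A.Definable₁ L S) :
    DefP L A (fun t => t ∈ S) :=
  ⟨Set.Definable.preimage_comp (β := Unit) (fun _ : Fin 1 => ()) h⟩

theorem IsPointOrInterval.finite_bdry {I : Set M} (hI : IsPointOrInterval I) :
    {t | IsBdry (fun s => s ∈ I) t}.Finite := by
  have key : ∀ B : Set M, B.Finite → (∀ t, t ∉ B → ∃ u w, u < t ∧ t < w ∧
      ((∀ s, u < s → s < w → s ∈ I) ∨ (∀ s, u < s → s < w → s ∉ I))) →
      {t | IsBdry (fun s => s ∈ I) t}.Finite := by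
    intro B hB h
    refine hB.subset fun t ht => ?_
    by_contra htB
    obtain ⟨u, w, hu, hw, h⟩ := h t htB
    obtain ⟨⟨s, h1, h2, h3⟩, ⟨s', h4, h5, h6⟩⟩ := ht u w hu hw
    rcases h with h | h
    · exact h6 (h _ h4 h5)
    · exact h _ h1 h2 h3
  rcases hI with ⟨a, rfl⟩ | ⟨a, b, rfl⟩ | ⟨a, rfl⟩ | ⟨a, rfl⟩ | rfl
  · refine key {a} (finite_singleton a) fun t ht => ?_
    rcases lt_or_gt_of_ne (show t ≠ a from ht) with h | h
    · exact ⟨t - 1, a, by linarith, h, Or.inr fun s _ h2 => h2.ne⟩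
    · exact ⟨a, t + 1, h, by linarith, Or.inr fun s h1 _ => h1.ne'⟩
  · refine key {a, b} (by simp) fun t ht => ?_
    simp only [mem_insert_iff, mem_singleton_iff, not_or] at ht
    rcases lt_or_gt_of_ne ht.1 with h | h
    · exact ⟨t - 1, a, by linarith, h, Or.inr fun s _ h2 h3 => h2.not_gt h3.1⟩
    · rcases lt_or_gt_of_ne ht.2 with h' | h'
      · exact ⟨a, b, h, h', Or.inl fun s h1 h2 => ⟨h1, h2⟩⟩
      · exact ⟨b, t + 1, h', by linarith, Or.inr fun s h1 _ h3 => h1.not_gt h3.2⟩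
  · refine key {a} (finite_singleton a) fun t ht => ?_
    rcases lt_or_gt_of_ne (show t ≠ a from ht) with h | h
    · exact ⟨t - 1, a, by linarith, h, Or.inl fun s _ h2 => h2⟩
    · exact ⟨a, t + 1, h, by linarith, Or.inr fun s h1 _ h2 => h1.not_gt h2⟩
  · refine key {a} (finite_singleton a) fun t ht => ?_
    rcases lt_or_gt_of_ne (show t ≠ a from ht) with h | h
    · exact ⟨t - 1, a, by linarith, h, Or.inr fun s _ h1 h2 => h1.not_gt h2⟩
    · exact ⟨a, t + 1, h, by linarith, Or.inl fun s h2 _ => h2⟩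
  · exact key ∅ finite_empty fun t _ =>
      ⟨t - 1, t + 1, by linarith, by linarith, Or.inl fun s _ _ => trivial⟩

theorem IsPointOrInterval.exists_isLUB {I : Set M} (hI : IsPointOrInterval I) (hne : I.Nonempty)
    (hb : BddAbove I) : ∃ s, IsLUB I s := by
  rcases hI with ⟨a, rfl⟩ | ⟨a, b, rfl⟩ | ⟨a, rfl⟩ | ⟨a, rfl⟩ | rfl
  · exact ⟨a, isLUB_singleton⟩
  · obtain ⟨c, hc⟩ := hne
    exact ⟨b, isLUB_Ioo (hc.1.trans hc.2)⟩
  · exact ⟨a, isLUB_Iio⟩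
  · exact absurd hb (not_bddAbove_Ioi a)
  · exact absurd hb not_bddAbove_univ

theorem IsOMinimal.tame (h : IsOMinimal L M) : Tame L M := by
  constructor
  · intro P hP hne hb
    obtain ⟨F, hF, hI, hS⟩ := h _ (definable₁_of_defP hP)
    suffices ∀ G ⊆ F, (⋃₀ G).Nonempty → BddAbove (⋃₀ G) → ∃ s, IsLUB (⋃₀ G) s by
      obtain ⟨s, hs⟩ := this F subset_rfl (by rw [← hS]; exact hne)
        (by rw [← hS]; obtain ⟨u, hu⟩ := hb; exact ⟨u, fun t ht => hu t ht⟩)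
      rw [← hS] at hs
      exact ⟨s, fun t ht => hs.1 ht, fun u hu => hs.2 hu⟩
    intro G hG
    induction G, hF.subset hG using Set.Finite.induction_on with
    | empty => simp
    | @insert I G _ _ ih =>
      intro hne hb
      rw [sUnion_insert] at hne hb ⊢
      have hbI := hb.mono subset_union_left
      have hbG := hb.mono subset_union_right
      have hGF : G ⊆ F := fun J hJ => hG (mem_insert_of_mem _ hJ)
      have hIF := hI I (hG (mem_insert _ _))
      rcases eq_empty_or_nonempty (⋃₀ G) with h1 | h1
      · rw [h1, union_empty] at hne ⊢
        exact hIF.exists_isLUB hne hbI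
      · obtain ⟨s, hs⟩ := ih hGF h1 hbG
        rcases eq_empty_or_nonempty I with h2 | h2
        · rw [h2, empty_union]
          exact ⟨s, hs⟩
        · obtain ⟨t, ht⟩ := hIF.exists_isLUB h2 hbI
          exact ⟨_, ht.union hs⟩
  · intro P hP
    obtain ⟨F, hF, hI, hS⟩ := h _ (definable₁_of_defP hP)
    refine (hF.biUnion fun I hIF => (hI I hIF).finite_bdry).subset fun t ht => ?_
    by_contra hcon
    simp only [mem_iUnion, not_exists] at hcon
    -- an interval around `t` on which every member of `G` is constant
    have : ∀ G ⊆ F, ∃ u w, u < t ∧ t < w ∧ ∀ s s', u < s → s < w → u < s' → s' < w →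
        ∀ I ∈ G, s ∈ I → s' ∈ I := by
      intro G hG
      induction G, hF.subset hG using Set.Finite.induction_on with
      | empty => exact ⟨t - 1, t + 1, by linarith, by linarith, by simp⟩
      | @insert I G _ _ ih =>
        obtain ⟨u, w, hu, hw, h⟩ := ih fun J hJ => hG (mem_insert_of_mem _ hJ)
        have h1 := hcon I (hG (mem_insert _ _))
        simp only [mem_ofPred_eq, IsBdry] at h1
        push Not at h1
        obtain ⟨u', w', hu', hw', h1⟩ := h1
        refine ⟨max u u', min w w', max_lt hu hu', lt_min hw hw', ?_⟩
        intro s s' h2 h3 h4 h5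
        simp only [max_lt_iff, lt_min_iff] at h2 h3 h4 h5
        intro J hJ
        rcases hJ with rfl | hJ
        · intro hs
          exact h1 ⟨s, h2.2, h3.2, hs⟩ s' h4.2 h5.2
        · exact h s s' h2.1 h3.1 h4.1 h5.1 J hJ
    obtain ⟨u, w, hu, hw, h⟩ := this F subset_rfl
    obtain ⟨⟨s, h1, h2, h3⟩, ⟨s', h4, h5, h6⟩⟩ := ht u w hu hw
    have h3' : s ∈ ⋃₀ F := hS ▸ h3
    obtain ⟨I, hIF, hs⟩ := h3'
    apply h6
    have : s' ∈ ⋃₀ F := ⟨I, hIF, h s s' h1 h2 h4 h5 I hIF hs⟩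
    rw [← hS] at this
    exact this

namespace Tame

variable (h : Tame L M)
include h

/-- Definable connectedness: between a point of `P` and a point outside `P` there is a boundary
point. -/
theorem exists_bdry {P : M → Prop} [DefP L (univ : Set M) P] {a b : M} (hab : a ≤ b)
    (hne : ¬ (P a ↔ P b)) : ∃ t, a ≤ t ∧ t ≤ b ∧ IsBdry P t := by
  -- `s` is the end of the longest interval from `a` on which `P` keeps its truth value
  obtain ⟨s, hs1, hs2⟩ := h.exists_isLUB
    (fun t => a ≤ t ∧ t ≤ b ∧ ∀ u, a ≤ u → u ≤ t → (P a ↔ P u)) inferInstance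
    ⟨a, le_rfl, hab, fun u h1 h2 => by rw [le_antisymm h1 h2]⟩ ⟨b, fun t ht => ht.2.1⟩
  have has : a ≤ s := hs1 a ⟨le_rfl, hab, fun u h1 h2 => by rw [le_antisymm h1 h2]⟩
  have hsb : s ≤ b := hs2 b fun t ht => ht.2.1
  refine ⟨s, has, hsb, ?_⟩
  intro u w hu hw
  have h1 : ∃ t, u < t ∧ t < w ∧ (P a ↔ P t) := by
    by_contra hcon
    refine absurd (hs2 u fun t ht => ?_) hu.not_ge
    by_contra htu
    exact hcon ⟨t, not_le.1 htu, (hs1 t ht).trans_lt hw, ht.2.2 t ht.1 le_rfl⟩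
  have h2 : ∃ t, u < t ∧ t < w ∧ ¬ (P a ↔ P t) := by
    by_contra hcon
    push Not at hcon
    have h3 : ∀ t, a ≤ t → t < w → (P a ↔ P t) := by
      intro t hat htw
      by_cases htu : t ≤ u
      · by_contra hne
        refine absurd (hs2 u fun t' ht' => ?_) hu.not_ge
        by_contra h'
        exact hne (ht'.2.2 t hat (htu.trans (not_le.1 h').le))
      · exact hcon t (not_le.1 htu) htw
    rcases lt_or_ge b w with hbw | hbw
    · exact hne (h3 b hab hbw)
    · obtain ⟨t, hst, htw⟩ := exists_between hw
      exact absurd (hs1 t ⟨has.trans hst.le, htw.le.trans hbw,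
        fun u' h4 h5 => h3 u' h4 (h5.trans_lt htw)⟩) hst.not_ge
  obtain ⟨t, ht1, ht2, ht3⟩ := h1
  obtain ⟨t', ht1', ht2', ht3'⟩ := h2
  by_cases hPa : P a
  · exact ⟨⟨t, ht1, ht2, by tauto⟩, ⟨t', ht1', ht2', by tauto⟩⟩
  · exact ⟨⟨t', ht1', ht2', by tauto⟩, ⟨t, ht1, ht2, by tauto⟩⟩

/-- To the right of every point, `P` is eventually true or eventually false. -/
theorem right_dichotomy (P : M → Prop) [hP : DefP L (univ : Set M) P] (x : M) :
    (∃ r, x < r ∧ ∀ t, x < t → t < r → P t) ∨ (∃ r, x < r ∧ ∀ t, x < t → t < r → ¬ P t) := by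
  obtain ⟨r, hr, hB⟩ : ∃ r, x < r ∧ ∀ b ∈ {t | IsBdry P t}, x < b → r ≤ b := by
    induction {t | IsBdry P t}, h.finite_bdry P hP using Set.Finite.induction_on with
    | empty => exact ⟨x + 1, by linarith, by simp⟩
    | @insert c B _ _ ih =>
      obtain ⟨r, hr, hB⟩ := ih
      by_cases hc : x < c
      · refine ⟨min r c, lt_min hr hc, fun b hb hxb => ?_⟩
        rcases hb with rfl | hb
        · exact min_le_right _ _
        · exact (min_le_left _ _).trans (hB b hb hxb)
      · refine ⟨r, hr, fun b hb hxb => ?_⟩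
        rcases hb with rfl | hb
        · exact absurd hxb hc
        · exact hB b hb hxb
  have key : ∀ t t', x < t → t ≤ t' → t' < r → (P t ↔ P t') := by
    intro t t' h1 h2 h3
    by_contra hne
    obtain ⟨b, hb1, hb2, hb3⟩ := h.exists_bdry h2 hne
    exact absurd (hB b hb3 (h1.trans_le hb1)) (hb2.trans_lt h3).not_ge
  obtain ⟨m, hm1, hm2⟩ := exists_between hr
  have key' : ∀ t, x < t → t < r → (P m ↔ P t) := by
    intro t h1 h2
    rcases le_total m t with h3 | h3
    · exact key m t hm1 h3 h2
    · exact (key t m h1 h3 hm2).symm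
  by_cases hPm : P m
  · exact Or.inl ⟨r, hr, fun t h1 h2 => (key' t h1 h2).1 hPm⟩
  · exact Or.inr ⟨r, hr, fun t h1 h2 h3 => hPm ((key' t h1 h2).2 h3)⟩

/-- An infinite definable set contains an interval. -/
theorem exists_interval {P : M → Prop} [hP : DefP L (univ : Set M) P] (hinf : {t | P t}.Infinite) :
    ∃ a b, a < b ∧ ∀ t, a < t → t < b → P t := by
  obtain ⟨t, ht, htB⟩ := (hinf.sdiff (h.finite_bdry P hP)).nonempty
  simp only [mem_ofPred_eq, IsBdry] at htB
  push Not at htB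
  obtain ⟨u, w, hu, hw, h1⟩ := htB
  by_cases hc : ∃ s, u < s ∧ s < w ∧ P s
  · exact ⟨u, w, hu.trans hw, h1 hc⟩
  · exact absurd ⟨t, hu, hw, ht⟩ hc

/-- Of two definable sets that cover an interval, one contains a subinterval. -/
theorem exists_subinterval (P : M → Prop) [DefP L (univ : Set M) P] {a b : M} (hab : a < b) :
    ∃ c d, a ≤ c ∧ c < d ∧ d ≤ b ∧
      ((∀ t, c < t → t < d → P t) ∨ (∀ t, c < t → t < d → ¬ P t)) := by
  rcases h.right_dichotomy P a with ⟨r, hr, h1⟩ | ⟨r, hr, h1⟩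
  · exact ⟨a, min r b, le_rfl, lt_min hr hab, min_le_right _ _,
      Or.inl fun t h2 h3 => h1 t h2 (h3.trans_le (min_le_left _ _))⟩
  · exact ⟨a, min r b, le_rfl, lt_min hr hab, min_le_right _ _,
      Or.inr fun t h2 h3 => h1 t h2 (h3.trans_le (min_le_left _ _))⟩

/-- A definable increasing family of sets `R η`, for `η` decreasing to `0`, that covers an
interval has a member that contains a subinterval. Otherwise the sets `R η` are finite, the set of
their minima is infinite and hence contains an interval, and `R η` contains all `v > u` in this
interval as soon as `u = min (R η)`. -/
theorem exists_uniform (R : M → M → Prop) [DefP L (univ : Set M) (fun z : M × M => R z.1 z.2)]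
    (hR : ∀ η η' x, η ≤ η' → R η' x → R η x) {a b : M} (hab : a < b)
    (hcov : ∀ x, a < x → x < b → ∃ η, 0 < η ∧ R η x) :
    ∃ c d, a ≤ c ∧ c < d ∧ d ≤ b ∧ ∃ η, 0 < η ∧ ∀ x, c < x → x < d → R η x := by
  by_contra hcon
  have hfin : ∀ η, 0 < η → {x | a < x ∧ x < b ∧ R η x}.Finite := by
    intro η hη
    by_contra hinf
    obtain ⟨c, d, hcd, h1⟩ := h.exists_interval (P := fun x => a < x ∧ x < b ∧ R η x) hinf
    obtain ⟨c', hc1, hc2⟩ := exists_between hcd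
    obtain ⟨d', hd1, hd2⟩ := exists_between hc2
    exact hcon ⟨c', d', (h1 c' hc1 hc2).1.le, hd1, (h1 d' (hc1.trans hd1) hd2).2.1.le, η, hη,
      fun x h3 h4 => (h1 x (hc1.trans h3) (h4.trans hd2)).2.2⟩
  -- the set of the minima of the sets `R η`
  let Im : M → Prop := fun x => a < x ∧ x < b ∧ ∃ η, 0 < η ∧ R η x ∧
    ∀ x', a < x' → x' < x → ¬ R η x'
  have hIm : ∀ c, a < c → c < b → ∃ x, x ≤ c ∧ Im x := by
    intro c h1 h2
    obtain ⟨η, hη, hRc⟩ := hcov c h1 h2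
    obtain ⟨x, hx, hmin⟩ := Set.exists_min_image _ (fun x => x) (hfin η hη) ⟨c, h1, h2, hRc⟩
    refine ⟨x, hmin c ⟨h1, h2, hRc⟩, hx.1, hx.2.1, η, hη, hx.2.2, ?_⟩
    intro x' h3 h4 h5
    exact absurd (hmin x' ⟨h3, h4.trans hx.2.1, h5⟩) h4.not_ge
  have hinf : {x | Im x}.Infinite := by
    intro hf
    obtain ⟨c, hc1, hc2⟩ := exists_between hab
    obtain ⟨x0, _, hx0⟩ := hIm c hc1 hc2
    obtain ⟨m, hm, hmin⟩ := Set.exists_min_image _ (fun x => x) hf ⟨x0, hx0⟩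
    obtain ⟨e, he1, he2⟩ := exists_between hm.1
    obtain ⟨x, hx1, hx2⟩ := hIm e he1 (he2.trans hm.2.1)
    exact absurd (hmin x hx2) (hx1.trans_lt he2).not_ge
  obtain ⟨p, q, hpq, hsub⟩ := h.exists_interval (P := Im) hinf
  obtain ⟨u, hu1, hu2⟩ := exists_between hpq
  obtain ⟨q', hq1, hq2⟩ := exists_between hu2
  obtain ⟨hau, hub, ηu, hηu, hRu, _⟩ := hsub u hu1 hu2
  refine hcon ⟨u, q', hau.le, hq1, (hsub q' (hu1.trans hq1) hq2).2.1.le, ηu, hηu, ?_⟩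
  intro x hx1 hx2
  obtain ⟨_, _, η, hη, hRx, hmin⟩ := hsub x (hu1.trans hx1) (hx2.trans hq2)
  rcases le_total η ηu with hle | hle
  · exact absurd (hR _ _ _ hle hRu) (hmin u hau hx1)
  · exact hR _ _ _ hle hRx

/-- A definable binary relation is constant on the increasing pairs from a suitable subinterval. -/
theorem exists_homogeneous (ρ : M → M → Prop) [DefP L (univ : Set M) (fun z : M × M => ρ z.1 z.2)]
    {a b : M} (hab : a < b) :
    ∃ c d, a ≤ c ∧ c < d ∧ d ≤ b ∧
      ((∀ s t, c < s → s < t → t < d → ρ s t) ∨ (∀ s t, c < s → s < t → t < d → ¬ ρ s t)) := by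
  have key : ∀ (σ : M → M → Prop) [DefP L (univ : Set M) (fun z : M × M => σ z.1 z.2)]
      (c d : M), c < d → (∀ x, c < x → x < d → ∃ r, x < r ∧ ∀ t, x < t → t < r → σ x t) →
      ∃ c' d', c ≤ c' ∧ c' < d' ∧ d' ≤ d ∧ ∀ s t, c' < s → s < t → t < d' → σ s t := by
    intro σ _ c d hcd h1
    obtain ⟨c', d', hc, hcd', hd, η, hη, h2⟩ := h.exists_uniform
      (fun η x => ∀ t, x < t → t < x + η → σ x t)
      (fun η η' x h3 h4 t h5 h6 => h4 t h5 (by linarith)) hcd (fun x h3 h4 => by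
        obtain ⟨r, hr, h5⟩ := h1 x h3 h4
        exact ⟨r - x, by linarith, fun t h6 h7 => h5 t h6 (by linarith)⟩)
    exact ⟨c', min d' (c' + η), hc, lt_min hcd' (by linarith), (min_le_left _ _).trans hd,
      fun s t h3 h4 h5 => h2 s h3 (h4.trans (h5.trans_le (min_le_left _ _))) t h4
        (by linarith [h5.trans_le (min_le_right d' (c' + η))])⟩
  obtain ⟨c, d, hc, hcd, hd, h1⟩ := h.exists_subinterval
    (fun x => ∃ r, x < r ∧ ∀ t, x < t → t < r → ρ x t) hab
  rcases h1 with h1 | h1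
  · obtain ⟨c', d', h2, h3, h4, h5⟩ := key ρ c d hcd h1
    exact ⟨c', d', hc.trans h2, h3, h4.trans hd, Or.inl h5⟩
  · obtain ⟨c', d', h2, h3, h4, h5⟩ := key (fun s t => ¬ ρ s t) c d hcd fun x h2 h3 =>
      (h.right_dichotomy (fun t => ρ x t) x).resolve_left (h1 x h2 h3)
    exact ⟨c', d', hc.trans h2, h3, h4.trans hd, Or.inr h5⟩

/-- Monotonicity: on a suitable subinterval, a definable function is strictly increasing,
constant, or strictly decreasing. -/
theorem exists_monotone (f : M → M) [DefF L (univ : Set M) f] {a b : M} (hab : a < b) :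
    ∃ c d, a ≤ c ∧ c < d ∧ d ≤ b ∧
      ((∀ s t, c < s → s < t → t < d → f s < f t) ∨ (∀ s t, c < s → s < t → t < d → f s = f t) ∨
        (∀ s t, c < s → s < t → t < d → f t < f s)) := by
  obtain ⟨c, d, hc, hcd, hd, h1 | h1⟩ := h.exists_homogeneous (fun s t => f s < f t) hab
  · exact ⟨c, d, hc, hcd, hd, Or.inl h1⟩
  obtain ⟨c', d', hc', hcd', hd', h2 | h2⟩ := h.exists_homogeneous (fun s t => f s = f t) hcd
  · exact ⟨c', d', hc.trans hc', hcd', hd'.trans hd, Or.inr (Or.inl h2)⟩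
  · refine ⟨c', d', hc.trans hc', hcd', hd'.trans hd, Or.inr (Or.inr fun s t h3 h4 h5 => ?_)⟩
    exact lt_of_le_of_ne (not_lt.1 (h1 s t (hc'.trans_lt h3) h4 (h5.trans_le hd')))
      fun h6 => h2 s t h3 h4 h5 h6.symm

end Tame
end Tame

/-! ### Continuity and differentiability of definable functions of one variable -/

section Calculus

variable {L : FirstOrder.Language.{u, v}} {M : Type w} [L.Structure M]
  [OrderedRingLanguage L] [Field M] [LinearOrder M] [IsStrictOrderedRing M]
  [OrderedFieldExpansion L M]

/-- Continuity at a point, in the `ε`-`δ` form over an ordered field. -/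
def ContAt (f : M → M) (t : M) : Prop :=
  ∀ ε, 0 < ε → ∃ δ, 0 < δ ∧ ∀ s, |s - t| < δ → |f s - f t| < ε

/-- `f` has derivative `d` at `t`, in the `ε`-`δ` form over an ordered field. -/
def HasD (f : M → M) (t d : M) : Prop :=
  ∀ ε, 0 < ε → ∃ δ, 0 < δ ∧ ∀ s, |s - t| < δ → |f s - f t - d * (s - t)| ≤ ε * |s - t|

theorem ContAt.add_linear {f : M → M} {t : M} (hf : ContAt f t) (c : M) :
    ContAt (fun s => f s + c * s) t := by
  intro ε hε
  obtain ⟨δ, hδ, h⟩ := hf (ε / 2) (by positivity)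
  have hc : 0 < |c| + 1 := by positivity
  refine ⟨min δ (ε / (2 * (|c| + 1))), by positivity, fun s hs => ?_⟩
  have h1 := h s (hs.trans_le (min_le_left _ _))
  have h2 := hs.trans_le (min_le_right _ _)
  rw [lt_div_iff₀ (by positivity)] at h2
  have h3 : |c * (s - t)| < ε / 2 := by
    rw [abs_mul]
    by_cases hst : |s - t| = 0
    · rw [hst, mul_zero]; positivity
    · have := lt_of_le_of_ne (abs_nonneg (s - t)) (Ne.symm hst)
      nlinarith
  calc |f s + c * s - (f t + c * t)| = |(f s - f t) + c * (s - t)| := by ring_nf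
    _ ≤ |f s - f t| + |c * (s - t)| := abs_add_le _ _
    _ < ε := by linarith

theorem ContAt.neg {f : M → M} {t : M} (hf : ContAt f t) : ContAt (fun s => - f s) t := by
  intro ε hε
  obtain ⟨δ, hδ, h⟩ := hf ε hε
  refine ⟨δ, hδ, fun s hs => ?_⟩
  rw [show - f s - - f t = -(f s - f t) by ring, abs_neg]
  exact h s hs

theorem HasD.contAt {f : M → M} {t d : M} (hf : HasD f t d) : ContAt f t := by
  intro ε hε
  obtain ⟨δ, hδ, h⟩ := hf 1 one_pos
  have hc : 0 < |d| + 1 := by positivity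
  refine ⟨min δ (ε / (|d| + 1)), by positivity, fun s hs => ?_⟩
  have h1 := h s (hs.trans_le (min_le_left _ _))
  have h2 := hs.trans_le (min_le_right _ _)
  rw [lt_div_iff₀ hc] at h2
  calc |f s - f t| = |(f s - f t - d * (s - t)) + d * (s - t)| := by ring_nf
    _ ≤ |f s - f t - d * (s - t)| + |d * (s - t)| := abs_add_le _ _
    _ ≤ 1 * |s - t| + |d| * |s - t| := by rw [abs_mul d]; gcongr
    _ < ε := by linarith

theorem HasD.neg {f : M → M} {t d : M} (hf : HasD f t d) : HasD (fun s => - f s) t (-d) := by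
  intro ε hε
  obtain ⟨δ, hδ, h⟩ := hf ε hε
  refine ⟨δ, hδ, fun s hs => ?_⟩
  rw [show - f s - - f t - -d * (s - t) = -(f s - f t - d * (s - t)) by ring, abs_neg]
  exact h s hs

theorem HasD.unique {f : M → M} {t d d' : M} (hf : HasD f t d) (hf' : HasD f t d') : d = d' := by
  by_contra hne
  have hpos : 0 < |d - d'| := abs_pos.2 (sub_ne_zero.2 hne)
  obtain ⟨δ, hδ, h⟩ := hf (|d - d'| / 4) (by positivity)
  obtain ⟨δ', hδ', h'⟩ := hf' (|d - d'| / 4) (by positivity)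
  have hη : 0 < min δ δ' / 2 := by positivity
  have e : t + min δ δ' / 2 - t = min δ δ' / 2 := by ring
  have h1 := h (t + min δ δ' / 2)
    (by rw [e, abs_of_pos hη]; linarith [min_le_left δ δ'])
  have h2 := h' (t + min δ δ' / 2)
    (by rw [e, abs_of_pos hη]; linarith [min_le_right δ δ'])
  rw [e, abs_of_pos hη] at h1 h2
  set η := min δ δ' / 2
  have h3 : |(d - d') * η| ≤ |d - d'| / 4 * η + |d - d'| / 4 * η := by
    calc |(d - d') * η| = |(f (t + η) - f t - d' * η) - (f (t + η) - f t - d * η)| := by ring_nf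
      _ ≤ |f (t + η) - f t - d' * η| + |f (t + η) - f t - d * η| := abs_sub _ _
      _ ≤ _ := add_le_add h2 h1
  rw [abs_mul, abs_of_pos hη] at h3
  nlinarith [mul_pos hpos hη]

namespace Tame

variable (h : Tame L M)
include h

/-- The image of a strictly monotone definable function contains an interval, over which the
function is continuous. -/
theorem exists_contAt_of_strictMono (f : M → M) [DefF L (univ : Set M) f] {a b : M} (hab : a < b)
    (hf : ∀ s t, a < s → s < t → t < b → f s < f t) :
    ∃ c d, a ≤ c ∧ c < d ∧ d ≤ b ∧ ∀ t, c < t → t < d → ContAt f t := by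
  have hlt : ∀ s t, a < s → s < b → a < t → t < b → f s < f t → s < t := by
    intro s t h1 h2 h3 h4 h5
    by_contra h6
    rcases (not_lt.1 h6).eq_or_lt with h7 | h7
    · rw [h7] at h5; exact h5.false
    · exact (hf t s h3 h7 h2).not_gt h5
  have hinf : {y | ∃ t, a < t ∧ t < b ∧ f t = y}.Infinite := by
    have h1 : (f '' Ioo a b).Infinite := by
      refine (Ioo_infinite hab).image ?_
      intro s hs t ht hst
      by_contra hne
      rcases lt_or_gt_of_ne hne with h2 | h2
      · exact (hf s t hs.1 h2 ht.2).ne hst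
      · exact (hf t s ht.1 h2 hs.2).ne' hst
    refine h1.mono ?_
    rintro _ ⟨t, ht, rfl⟩
    exact ⟨t, ht.1, ht.2, rfl⟩
  obtain ⟨p, q, hpq, himg⟩ := h.exists_interval
    (P := fun y => ∃ t, a < t ∧ t < b ∧ f t = y) hinf
  obtain ⟨p', hp1, hp2⟩ := exists_between hpq
  obtain ⟨q', hq1, hq2⟩ := exists_between hp2
  obtain ⟨c, hc1, hc2, hc3⟩ := himg p' hp1 (hq1.trans hq2)
  obtain ⟨d, hd1, hd2, hd3⟩ := himg q' (hp1.trans hq1) hq2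
  have hcd : c < d := hlt c d hc1 hc2 hd1 hd2 (by rw [hc3, hd3]; exact hq1)
  refine ⟨c, d, hc1.le, hcd, hd2.le, fun t ht1 ht2 ε hε => ?_⟩
  have hft1 : p' < f t := hc3 ▸ hf c t hc1 ht1 (ht2.trans hd2)
  have hft2 : f t < q' := hd3 ▸ hf t d (hc1.trans ht1) ht2 hd2
  obtain ⟨y1, hy1, hy1'⟩ := exists_between (max_lt hft1 (sub_lt_self (f t) hε))
  obtain ⟨y2, hy2, hy2'⟩ := exists_between (lt_min hft2 (lt_add_of_pos_right (f t) hε))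
  simp only [max_lt_iff, lt_min_iff] at hy1 hy2'
  obtain ⟨t1, ht1a, ht1b, ht1c⟩ := himg y1 (hp1.trans hy1.1) (hy1'.trans (hft2.trans hq2))
  obtain ⟨t2, ht2a, ht2b, ht2c⟩ := himg y2 (hp1.trans (hft1.trans hy2)) (hy2'.1.trans hq2)
  have h1 : t1 < t := hlt t1 t ht1a ht1b (hc1.trans ht1) (ht2.trans hd2) (by rwa [ht1c])
  have h2 : t < t2 := hlt t t2 (hc1.trans ht1) (ht2.trans hd2) ht2a ht2b (by rwa [ht2c])
  refine ⟨min (t - t1) (t2 - t), lt_min (sub_pos.2 h1) (sub_pos.2 h2), fun s hs => ?_⟩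
  rw [lt_min_iff, abs_lt, abs_lt] at hs
  have h3 := hf t1 s ht1a (by linarith) (by linarith)
  have h4 := hf s t2 (by linarith) (by linarith) ht2b
  rw [abs_lt]
  constructor <;> linarith

theorem exists_contAt (f : M → M) [DefF L (univ : Set M) f] {a b : M} (hab : a < b) :
    ∃ c d, a ≤ c ∧ c < d ∧ d ≤ b ∧ ∀ t, c < t → t < d → ContAt f t := by
  obtain ⟨c, d, hc, hcd, hd, h1 | h1 | h1⟩ := h.exists_monotone f hab
  · obtain ⟨c', d', h2, h3, h4, h5⟩ := h.exists_contAt_of_strictMono f hcd h1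
    exact ⟨c', d', hc.trans h2, h3, h4.trans hd, h5⟩
  · refine ⟨c, d, hc, hcd, hd, fun t h2 h3 ε hε => ?_⟩
    refine ⟨min (t - c) (d - t), lt_min (sub_pos.2 h2) (sub_pos.2 h3), fun s hs => ?_⟩
    rw [lt_min_iff, abs_lt, abs_lt] at hs
    have : f s = f t := by
      rcases lt_trichotomy s t with h4 | h4 | h4
      · exact h1 s t (by linarith) h4 h3
      · rw [h4]
      · exact (h1 t s h2 h4 (by linarith)).symm
    rw [this, sub_self, abs_zero]
    exact hε
  · obtain ⟨c', d', h2, h3, h4, h5⟩ := h.exists_contAt_of_strictMono (fun s => - f s) hcd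
      (fun s t h2 h3 h4 => neg_lt_neg (h1 s t h2 h3 h4))
    exact ⟨c', d', hc.trans h2, h3, h4.trans hd, fun t h6 h7 => by simpa using (h5 t h6 h7).neg⟩

/-- A continuous definable function `g` with `g x ≤ g u` for all `u` slightly to the right of `x`,
for each `x`, is monotone. -/
theorem le_of_right_le (g : M → M) [DefF L (univ : Set M) g] {s t : M} (hst : s ≤ t)
    (hg : ∀ x, s ≤ x → x ≤ t → ContAt g x)
    (hr : ∀ x, s ≤ x → x < t → ∃ r, x < r ∧ ∀ u, x < u → u < r → g x ≤ g u) : g s ≤ g t := by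
  obtain ⟨σ, h1, h2⟩ := h.exists_isLUB (fun u => s ≤ u ∧ u ≤ t ∧ ∀ v, s ≤ v → v ≤ u → g s ≤ g v)
    inferInstance ⟨s, le_rfl, hst, fun v h1 h2 => by rw [le_antisymm h1 h2]⟩ ⟨t, fun u hu => hu.2.1⟩
  have hsσ : s ≤ σ := h1 s ⟨le_rfl, hst, fun v h1 h2 => by rw [le_antisymm h1 h2]⟩
  have hσt : σ ≤ t := h2 t fun u hu => hu.2.1
  have hbelow : ∀ v, s ≤ v → v < σ → g s ≤ g v := by
    intro v hv1 hv2
    by_contra hcon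
    refine absurd (h2 v fun u hu => ?_) hv2.not_ge
    by_contra huv
    exact hcon (hu.2.2 v hv1 (not_le.1 huv).le)
  have hσ : g s ≤ g σ := by
    by_contra hcon
    have hlt : g σ < g s := not_le.1 hcon
    obtain ⟨δ, hδ, h3⟩ := hg σ hsσ hσt (g s - g σ) (sub_pos.2 hlt)
    have hne : s < σ := lt_of_le_of_ne hsσ (by rintro rfl; exact hlt.false)
    obtain ⟨v, hv1, hv2⟩ := exists_between (max_lt hne (sub_lt_self σ hδ))
    rw [max_lt_iff] at hv1
    have h4 := h3 v (by rw [abs_lt]; constructor <;> linarith)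
    rw [abs_lt] at h4
    linarith [hbelow v hv1.1.le hv2]
  rcases hσt.eq_or_lt with h3 | h3
  · rwa [h3] at hσ
  · obtain ⟨r, hr1, hr2⟩ := hr σ hsσ h3
    obtain ⟨u, hu1, hu2⟩ := exists_between (lt_min hr1 h3)
    rw [lt_min_iff] at hu2
    refine absurd (h1 u ⟨hsσ.trans hu1.le, hu2.2.le, fun v hv1 hv2 => ?_⟩) hu1.not_ge
    rcases lt_trichotomy v σ with h4 | h4 | h4
    · exact hbelow v hv1 h4
    · rwa [h4]
    · exact hσ.trans (hr2 v h4 (hv2.trans_lt hu2.1))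

/-- A definable function with nonnegative derivatives is monotone: add `ε x` to it to make the
previous lemma applicable. -/
theorem le_of_hasD_nonneg (f : M → M) [DefF L (univ : Set M) f] {s t : M} (hst : s ≤ t)
    (hf : ∀ x, s ≤ x → x ≤ t → ∃ d, 0 ≤ d ∧ HasD f x d) : f s ≤ f t := by
  have key : ∀ ε, 0 < ε → f s + ε * s ≤ f t + ε * t := by
    intro ε hε
    refine h.le_of_right_le (fun x => f x + ε * x) hst (fun x h1 h2 => ?_) fun x h1 h2 => ?_
    · obtain ⟨d, _, hd⟩ := hf x h1 h2
      exact hd.contAt.add_linear ε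
    · obtain ⟨d, hd0, hd⟩ := hf x h1 h2.le
      obtain ⟨δ, hδ, h3⟩ := hd ε hε
      refine ⟨x + δ, by linarith, fun u hu1 hu2 => ?_⟩
      have h4 := h3 u (by rw [abs_lt]; constructor <;> linarith)
      rw [abs_of_pos (sub_pos.2 hu1), abs_le] at h4
      nlinarith [mul_nonneg hd0 (sub_pos.2 hu1).le]
  by_contra hcon
  have hlt := not_le.1 hcon
  have hst' : s < t := lt_of_le_of_ne hst (by rintro rfl; exact hlt.false)
  have h1 := key ((f s - f t) / (2 * (t - s)))
    (div_pos (sub_pos.2 hlt) (by linarith))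
  have h2 : (f s - f t) / (2 * (t - s)) * (t - s) = (f s - f t) / 2 := by
    have : t - s ≠ 0 := (sub_pos.2 hst').ne'
    field_simp
  nlinarith

/-- An increasing continuous definable function is differentiable somewhere. The lower right
derivative `D` is finite on a subinterval, since otherwise the growth of `f` would exceed every
linear growth; and `f` is differentiable wherever `D` is continuous. -/
theorem exists_hasD_of_mono (f : M → M) [DefF L (univ : Set M) f] {a b : M} (hab : a < b)
    (hf : ∀ s t, a < s → s < t → t < b → f s ≤ f t) (hc : ∀ t, a < t → t < b → ContAt f t) :
    ∃ t d, a < t ∧ t < b ∧ HasD f t d := by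
  let Q : M → M → Prop := fun c x => ∃ r, x < r ∧ ∀ t, x < t → t < r → c * (t - x) ≤ f t - f x
  have hQ0 : ∀ x, a < x → x < b → Q 0 x := fun x h1 h2 =>
    ⟨b, h2, fun t h3 h4 => by linarith [hf x t h1 h3 h4]⟩
  have hQ : ∀ c c' x, c ≤ c' → Q c' x → Q c x := by
    rintro c c' x hcc ⟨r, hr, h1⟩
    exact ⟨r, hr, fun t h2 h3 => by nlinarith [h1 t h2 h3]⟩
  have hnQ : ∀ c x, ¬ Q c x → ∃ r, x < r ∧ ∀ t, x < t → t < r → f t - f x < c * (t - x) := by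
    intro c x h1
    obtain ⟨r, hr, h2⟩ := (h.right_dichotomy (fun t => c * (t - x) ≤ f t - f x) x).resolve_left h1
    exact ⟨r, hr, fun t h3 h4 => not_le.1 (h2 t h3 h4)⟩
  have up : ∀ c s t, a < s → s ≤ t → t < b → (∀ x, s ≤ x → x ≤ t → Q c x) →
      c * (t - s) ≤ f t - f s := by
    intro c s t h1 h2 h3 h4
    have := h.le_of_right_le (fun x => f x + (-c) * x) h2
      (fun x h5 h6 => (hc x (h1.trans_le h5) (h6.trans_lt h3)).add_linear _) (fun x h5 h6 => by
        obtain ⟨r, hr, h7⟩ := h4 x h5 h6.le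
        exact ⟨r, hr, fun u hu1 hu2 => by linarith [h7 u hu1 hu2]⟩)
    linarith
  have down : ∀ c s t, a < s → s ≤ t → t < b → (∀ x, s ≤ x → x ≤ t → ¬ Q c x) →
      f t - f s ≤ c * (t - s) := by
    intro c s t h1 h2 h3 h4
    have := h.le_of_right_le (fun x => - f x + c * x) h2
      (fun x h5 h6 => (hc x (h1.trans_le h5) (h6.trans_lt h3)).neg.add_linear _) (fun x h5 h6 => by
        obtain ⟨r, hr, h7⟩ := hnQ c x (h4 x h5 h6.le)
        exact ⟨r, hr, fun u hu1 hu2 => by linarith [h7 u hu1 hu2]⟩)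
    linarith
  obtain ⟨a1, b1, ha1, hab1, hb1, hP⟩ := h.exists_subinterval (fun x => ∃ c, ¬ Q c x) hab
  have hP : ∀ x, a1 < x → x < b1 → ∃ c, ¬ Q c x := by
    rcases hP with hP | hP
    · exact hP
    · obtain ⟨s, hs1, hs2⟩ := exists_between hab1
      obtain ⟨t, ht1, ht2⟩ := exists_between hs2
      have h1 := up ((f t - f s + 1) / (t - s)) s t (ha1.trans_lt hs1) ht1.le (ht2.trans_le hb1)
        fun x h2 h3 => by
          by_contra h4
          exact hP x (hs1.trans_le h2) (h3.trans_lt ht2) ⟨_, h4⟩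
      rw [div_mul_cancel₀ _ (sub_pos.2 ht1).ne'] at h1
      linarith
  -- the lower right derivative, as the supremum of the `c` with `Q c x`
  let D : M → M := fun x => OMin.the fun d => (∀ c, Q c x → c ≤ d) ∧
    ∀ u, (∀ c, Q c x → c ≤ u) → d ≤ u
  have hD : ∀ x, a1 < x → x < b1 → (∀ c, Q c x → c ≤ D x) ∧
      ∀ u, (∀ c, Q c x → c ≤ u) → D x ≤ u := by
    intro x h1 h2
    obtain ⟨c0, hc0⟩ := hP x h1 h2
    obtain ⟨d, hd1, hd2⟩ := h.exists_isLUB (fun c => Q c x) inferInstance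
      ⟨0, hQ0 x (ha1.trans_lt h1) (h2.trans_le hb1)⟩ ⟨c0, fun c hc => by
        by_contra hcc
        exact hc0 (hQ _ _ x (not_le.1 hcc).le hc)⟩
    have : D x = d := the_eq ⟨hd1, hd2⟩ fun y hy => le_antisymm (hy.2 d hd1) (hd2 y hy.1)
    rw [this]
    exact ⟨hd1, hd2⟩
  obtain ⟨a2, b2, ha2, hab2, hb2, hcont⟩ := h.exists_contAt D hab1
  obtain ⟨t, ht1, ht2⟩ := exists_between hab2
  refine ⟨t, D t, (ha1.trans ha2).trans_lt ht1, ht2.trans_le (hb2.trans hb1), fun ε hε => ?_⟩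
  obtain ⟨δ, hδ, h1⟩ := hcont t ht1 ht2 ε hε
  refine ⟨min δ (min (t - a2) (b2 - t)),
    lt_min hδ (lt_min (sub_pos.2 ht1) (sub_pos.2 ht2)), fun s hs => ?_⟩
  simp only [lt_min_iff] at hs
  have hrange : ∀ x, |x - t| ≤ |s - t| → a2 < x ∧ x < b2 ∧ |D x - D t| < ε := by
    intro x hx
    refine ⟨?_, ?_, h1 x (hx.trans_lt hs.1)⟩
    · linarith [(abs_le.1 hx).1]
    · linarith [(abs_le.1 hx).2]
  have hlow : ∀ x, |x - t| ≤ |s - t| → Q (D t - ε) x := by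
    intro x hx
    obtain ⟨h2, h3, h4⟩ := hrange x hx
    by_contra hcon
    have := (hD x (ha2.trans_lt h2) (h3.trans_le hb2)).2 (D t - ε) fun c hc' => by
      by_contra hcc
      exact hcon (hQ _ _ x (not_le.1 hcc).le hc')
    linarith [(abs_lt.1 h4).1]
  have hup : ∀ x, |x - t| ≤ |s - t| → ¬ Q (D t + ε) x := by
    intro x hx hQx
    obtain ⟨h2, h3, h4⟩ := hrange x hx
    have := (hD x (ha2.trans_lt h2) (h3.trans_le hb2)).1 _ hQx
    linarith [(abs_lt.1 h4).2]
  have hat : a < t := (ha1.trans ha2).trans_lt ht1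
  have htb : t < b := ht2.trans_le (hb2.trans hb1)
  have has : a < s := by linarith [(hrange s le_rfl).1]
  have hsb : s < b := by linarith [(hrange s le_rfl).2.1]
  rcases le_total t s with hts | hts
  · have e : ∀ x, t ≤ x → x ≤ s → |x - t| ≤ |s - t| := fun x h2 h3 => by
      rw [abs_of_nonneg (sub_nonneg.2 h2), abs_of_nonneg (sub_nonneg.2 hts)]; linarith
    have h2 := up _ t s hat hts hsb fun x h2 h3 => hlow x (e x h2 h3)
    have h3 := down _ t s hat hts hsb fun x h2 h3 => hup x (e x h2 h3)
    rw [abs_of_nonneg (sub_nonneg.2 hts), abs_le]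
    constructor <;> linarith
  · have e : ∀ x, s ≤ x → x ≤ t → |x - t| ≤ |s - t| := fun x h2 h3 => by
      rw [abs_of_nonpos (sub_nonpos.2 h3), abs_of_nonpos (sub_nonpos.2 hts)]; linarith
    have h2 := up _ s t has hts htb fun x h2 h3 => hlow x (e x h2 h3)
    have h3 := down _ s t has hts htb fun x h2 h3 => hup x (e x h2 h3)
    rw [abs_of_nonpos (sub_nonpos.2 hts), abs_le]
    constructor <;> linarith

/-- A definable function is differentiable at some point of each interval. -/
theorem exists_hasD (f : M → M) [DefF L (univ : Set M) f] {a b : M} (hab : a < b) :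
    ∃ t d, a < t ∧ t < b ∧ HasD f t d := by
  obtain ⟨a1, b1, ha1, hab1, hb1, hcont⟩ := h.exists_contAt f hab
  obtain ⟨a2, b2, ha2, hab2, hb2, hmono⟩ := h.exists_monotone f hab1
  have hcont' : ∀ t, a2 < t → t < b2 → ContAt f t := fun t h1 h2 =>
    hcont t (ha2.trans_lt h1) (h2.trans_le hb2)
  have key : ∃ t d, a2 < t ∧ t < b2 ∧ HasD f t d := by
    rcases hmono with h1 | h1 | h1
    · exact h.exists_hasD_of_mono f hab2 (fun s t h2 h3 h4 => (h1 s t h2 h3 h4).le) hcont'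
    · exact h.exists_hasD_of_mono f hab2 (fun s t h2 h3 h4 => (h1 s t h2 h3 h4).le) hcont'
    · obtain ⟨t, d, h2, h3, h4⟩ := h.exists_hasD_of_mono (fun s => - f s) hab2
        (fun s t h2 h3 h4 => (neg_lt_neg (h1 s t h2 h3 h4)).le) fun t h2 h3 => (hcont' t h2 h3).neg
      exact ⟨t, -d, h2, h3, by simpa using h4.neg⟩
  obtain ⟨t, d, h1, h2, h3⟩ := key
  exact ⟨t, d, (ha1.trans ha2).trans_lt h1, h2.trans_le (hb2.trans hb1), h3⟩

end Tame
end Calculus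

/-! ### Uniform finiteness -/

section UniformFiniteness

theorem le_ncard_iff {M : Type w} {S : Set M} (hS : S.Finite) (n : ℕ) :
    n ≤ S.ncard ↔ ∃ v : Fin n → M, (∀ i j, v i = v j → i = j) ∧ ∀ i, v i ∈ S := by
  constructor
  · intro hn
    obtain ⟨T, hTS, hT⟩ := Set.exists_subset_card_eq hn
    have : Finite T := hS.subset hTS
    let e : T ≃ Fin n := Finite.equivFinOfCardEq (by rw [Nat.card_coe_set_eq, hT])
    exact ⟨fun i => e.symm i, fun i j hij => e.symm.injective (Subtype.ext hij),
      fun i => hTS (e.symm i).2⟩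
  · rintro ⟨v, hv, hvS⟩
    have h1 : (range v).ncard = n := by
      rw [← image_univ, ncard_image_of_injective _ (fun i j => hv i j), ncard_univ, Nat.card_fin]
    rw [← h1]
    exact ncard_le_ncard (range_subset_iff.2 hvS) hS

variable {L : FirstOrder.Language.{u, v}} {M : Type w} [L.Structure M]
  [OrderedRingLanguage L] [Field M] [LinearOrder M] [IsStrictOrderedRing M]
  [OrderedFieldExpansion L M]

theorem exists_pos_forall_of_finite {S : Set M} (hS : S.Finite) (p : M → M → Prop)
    (hp : ∀ η η' y, η ≤ η' → p η' y → p η y) (h : ∀ y ∈ S, ∃ η, 0 < η ∧ p η y) :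
    ∃ η, 0 < η ∧ ∀ y ∈ S, p η y := by
  induction S, hS using Set.Finite.induction_on with
  | empty => exact ⟨1, one_pos, by simp⟩
  | @insert y S _ _ ih =>
    obtain ⟨η, hη, h1⟩ := ih fun y' hy' => h y' (mem_insert_of_mem _ hy')
    obtain ⟨η', hη', h2⟩ := h y (mem_insert _ _)
    refine ⟨min η η', lt_min hη hη', fun y' hy' => ?_⟩
    rcases hy' with rfl | hy'
    · exact hp _ _ _ (min_le_right _ _) h2
    · exact hp _ _ _ (min_le_left _ _) (h1 y' hy')

/-- The point `(t, y)` is normal for the planar set `A`: near `(t, y)` the set `A` is empty, or it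
is the graph of a function which is continuous at `t` with value `y`. -/
def IsNormal (A : M → M → Prop) (t y : M) : Prop :=
  (∃ η, 0 < η ∧ ∀ s w, |s - t| < η → |w - y| < η → ¬ A s w) ∨
  (A t y ∧ (∃ η, 0 < η ∧ ∀ s w w', |s - t| < η → |w - y| < η → |w' - y| < η →
      A s w → A s w' → w = w') ∧
    ∀ ε, 0 < ε → ∃ δ, 0 < δ ∧ ∀ s, |s - t| < δ → ∃ w, |w - y| < ε ∧ A s w)

instance DefP.isNormal {X Y : Type w} [TupleSpace M X] [TupleSpace M Y] {B : Set M}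
    {A : X × M → M → Prop}
    [DefP L B (fun z : (X × M) × M => A z.1 z.2)] {x : Y → X} {t y : Y → M} [DefF L B x]
    [DefF L B t] [DefF L B y] :
    DefP L B (fun z => IsNormal (fun s w => A (x z, s) w) (t z) (y z)) := by
  unfold IsNormal
  infer_instance

instance DefP.isNormal_const {Y : Type w} [TupleSpace M Y] {B : Set M} {A : M → M → Prop}
    [DefP L B (fun z : M × M => A z.1 z.2)] {t y : Y → M} [DefF L B t] [DefF L B y] :
    DefP L B (fun z => IsNormal A (t z) (y z)) := by
  unfold IsNormal
  infer_instance

/-- Normality of `(t, y)` is an open condition on `y`. -/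
theorem IsNormal.eventually {A : M → M → Prop} {t y : M} (hn : IsNormal A t y) :
    ∃ η, 0 < η ∧ ∀ y', |y' - y| < η → IsNormal A t y' := by
  rcases hn with ⟨η, hη, h1⟩ | ⟨hA, ⟨η, hη, h1⟩, h2⟩
  · refine ⟨η / 2, by positivity, fun y' hy' => Or.inl ⟨η / 2, by positivity, fun s w hs hw => ?_⟩⟩
    refine h1 s w (by linarith) ?_
    calc |w - y| = |(w - y') + (y' - y)| := by ring_nf
      _ ≤ |w - y'| + |y' - y| := abs_add_le _ _
      _ < η := by linarith
  · refine ⟨η, hη, fun y' hy' => ?_⟩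
    by_cases hy : y' = y
    · rw [hy]
      exact Or.inr ⟨hA, ⟨η, hη, h1⟩, h2⟩
    · left
      have hpos : 0 < |y' - y| := abs_pos.2 (sub_ne_zero.2 hy)
      -- near `(t, y)` the graph stays within `ε` of `y`, and `y'` is at distance `2 ε` from `y`
      set ε := |y' - y| / 2
      obtain ⟨δ, hδ, h3⟩ := h2 ε (by positivity)
      refine ⟨min (min δ η) (min ε (η - |y' - y|)),
        lt_min (lt_min hδ hη) (lt_min (by positivity) (by linarith)), fun s w hs hw hAw => ?_⟩
      simp only [lt_min_iff] at hs hw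
      obtain ⟨w', hw', hAw'⟩ := h3 s hs.1.1
      have h4 : |w - y| < η := by
        calc |w - y| = |(w - y') + (y' - y)| := by ring_nf
          _ ≤ |w - y'| + |y' - y| := abs_add_le _ _
          _ < η := by linarith [hw.2.2]
      have h5 : |w' - y| < η := by
        have : ε < η := by simp only [ε]; linarith
        linarith
      have h6 := h1 s w w' hs.1.2 h4 h5 hAw hAw'
      rw [← h6] at hw'
      have h7 : |y' - y| ≤ |w - y'| + |w - y| := by
        calc |y' - y| = |(w - y) - (w - y')| := by ring_nf
          _ ≤ |w - y| + |w - y'| := abs_sub _ _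
          _ = _ := add_comm _ _
      have h8 : |y' - y| = ε + ε := by simp only [ε]; ring
      linarith [hw.2.1]

namespace Tame

variable (h : Tame L M)
include h

/-- Definable compactness of `{t} × [-1, 1]`. -/
theorem exists_tube (B : M → M → Prop) [DefP L (univ : Set M) (fun z : M × M => B z.1 z.2)]
    (hB : ∀ s v, B s v → -1 < v ∧ v < 1) (t : M)
    (hloc : ∀ w, ∃ η, 0 < η ∧ ∀ s v, |s - t| < η → |v - w| < η → ¬ B s v) :
    ∃ δ, 0 < δ ∧ ∀ s v, |s - t| < δ → ¬ B s v := by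
  let S : M → Prop := fun u => ∃ δ, 0 < δ ∧ ∀ s v, |s - t| < δ → v ≤ u → ¬ B s v
  by_cases h1 : S 1
  · obtain ⟨δ, hδ, h2⟩ := h1
    exact ⟨δ, hδ, fun s v hs hv => h2 s v hs (hB s v hv).2.le hv⟩
  · exfalso
    have hbd : ∀ u, S u → u ≤ 1 := by
      rintro u ⟨δ, hδ, h2⟩
      by_contra hu
      exact h1 ⟨δ, hδ, fun s v hs hv => h2 s v hs (hv.trans (not_le.1 hu).le)⟩
    obtain ⟨σ, hσ1, hσ2⟩ := h.exists_isLUB S inferInstance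
      ⟨-1, 1, one_pos, fun s v _ hv hBv => (hB s v hBv).1.not_ge hv⟩ ⟨1, hbd⟩
    obtain ⟨η, hη, h2⟩ := hloc σ
    obtain ⟨u, ⟨δ, hδ, h3⟩, hu⟩ : ∃ u, S u ∧ σ - η < u := by
      by_contra hcon
      push Not at hcon
      linarith [hσ2 _ hcon]
    have : S (σ + η / 2) := by
      refine ⟨min δ η, lt_min hδ hη, fun s v hs hv => ?_⟩
      rw [lt_min_iff] at hs
      by_cases hvu : v ≤ u
      · exact h3 s v hs.1 hvu
      · exact h2 s v hs.2 (by rw [abs_lt]; constructor <;> linarith)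
    linarith [hσ1 _ this]

variable (A : M → M → Prop) [hA : DefP L (univ : Set M) (fun z : M × M => A z.1 z.2)]
  (hfin : ∀ t, {y | A t y}.Finite) (hbd : ∀ t y, A t y → -1 < y ∧ y < 1)
include hA hfin hbd

/-- If `{t} × M` consists of normal points, then the number of points of `A` above `s` is constant
for `s` near `t`: there is exactly one near each point above `t`, and by compactness no other. -/
theorem ncard_eventually_eq {t : M} (ht : ∀ y, IsNormal A t y) :
    ∃ δ, 0 < δ ∧ ∀ s, |s - t| < δ → {y | A s y}.ncard = {y | A t y}.ncard := by
  have hnorm : ∀ y, A t y → (∃ η, 0 < η ∧ ∀ s w w', |s - t| < η → |w - y| < η → |w' - y| < η →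
      A s w → A s w' → w = w') ∧
      ∀ ε, 0 < ε → ∃ δ, 0 < δ ∧ ∀ s, |s - t| < δ → ∃ w, |w - y| < ε ∧ A s w := by
    intro y hy
    rcases ht y with ⟨η, hη, h1⟩ | ⟨_, h1⟩
    · exact absurd hy (h1 t y (by simpa using hη) (by simpa using hη))
    · exact h1
  obtain ⟨η1, hη1, h1⟩ := exists_pos_forall_of_finite (hfin t)
    (fun η y => ∀ s w w', |s - t| < η → |w - y| < η → |w' - y| < η → A s w → A s w' → w = w')
    (fun η η' y hle h1 s w w' h2 h3 h4 => h1 s w w' (h2.trans_le hle) (h3.trans_le hle)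
      (h4.trans_le hle)) (fun y hy => (hnorm y hy).1)
  obtain ⟨η2, hη2, h2⟩ := exists_pos_forall_of_finite (hfin t)
    (fun η y => ∀ y', A t y' → y ≠ y' → η + η ≤ |y - y'|)
    (fun η η' y hle h1 y' h2 h3 => by linarith [h1 y' h2 h3])
    (fun y _ => by
      obtain ⟨η, hη, h3⟩ := exists_pos_forall_of_finite (hfin t)
        (fun η y' => y ≠ y' → η + η ≤ |y - y'|)
        (fun η η' y' hle h1 h2 => by linarith [h1 h2])
        (fun y' _ => by
          by_cases hyy : y = y'
          · exact ⟨1, one_pos, fun h => absurd hyy h⟩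
          · exact ⟨|y - y'| / 2, by have := abs_pos.2 (sub_ne_zero.2 hyy); positivity,
              fun _ => by linarith⟩)
      exact ⟨η, hη, fun y' hy' => h3 y' hy'⟩)
  set η := min η1 η2 with hηdef
  have hη : 0 < η := lt_min hη1 hη2
  have hle1 : η ≤ η1 := min_le_left _ _
  have hle2 : η ≤ η2 := min_le_right _ _
  obtain ⟨δ1, hδ1, h3⟩ := exists_pos_forall_of_finite (hfin t)
    (fun δ y => ∀ s, |s - t| < δ → ∃ w, |w - y| < η ∧ A s w)
    (fun δ δ' y hle h1 s hs => h1 s (hs.trans_le hle)) (fun y hy => (hnorm y hy).2 η hη)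
  obtain ⟨δ2, hδ2, h4⟩ := h.exists_tube (fun s v => A s v ∧ ∀ y, A t y → η ≤ |v - y|)
    (fun s v hv => hbd s v hv.1) t (fun w => by
      rcases ht w with ⟨η', hη', h5⟩ | ⟨hw, _⟩
      · exact ⟨η', hη', fun s v hs hv hB => h5 s v hs hv hB.1⟩
      · exact ⟨η, hη, fun s v _ hv hB => (hB.2 w hw).not_gt hv⟩)
  refine ⟨min η (min δ1 δ2), lt_min hη (lt_min hδ1 hδ2), fun s hs => ?_⟩
  simp only [lt_min_iff] at hs
  choose f hf1 hf2 using fun (y : M) (hy : A t y) => h3 y hy s hs.2.1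
  symm
  refine Set.ncard_congr (fun y hy => f y hy) (fun y hy => hf2 y hy) ?_ ?_
  · intro y y' hy hy' hff
    by_contra hne
    have h5 := h2 y hy y' hy' hne
    have h6 := hf1 y hy
    have h7 := hf1 y' hy'
    have h8 : |y - y'| ≤ |f y hy - y| + |f y' hy' - y'| := by
      rw [← hff]
      calc |y - y'| = |(f y hy - y') - (f y hy - y)| := by ring_nf
        _ ≤ |f y hy - y'| + |f y hy - y| := abs_sub _ _
        _ = _ := add_comm _ _
    linarith
  · intro v hv
    have h5 := h4 s v hs.2.2
    push Not at h5
    obtain ⟨y, hy, hvy⟩ := h5 hv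
    exact ⟨y, hy, h1 y hy s _ _ (hs.1.trans_le hle1) ((hf1 y hy).trans_le hle1)
      (hvy.trans_le hle1) (hf2 y hy) hv⟩

/-- Only finitely many vertical lines contain a point that is not normal. Otherwise let `β t` be
the least `y` such that `(t, y)` is not normal. On a suitable interval `β` is continuous, the
points of `A` above `t` other than `β t` keep a fixed distance from `β t`, and `A` contains the
graph of `β` or is disjoint from it; so `(t, β t)` is normal. -/
theorem finite_not_normal : {t | ∃ y, ¬ IsNormal A t y}.Finite := by
  by_contra hinf
  obtain ⟨a, b, hab, h1⟩ := h.exists_interval (P := fun t => ∃ y, ¬ IsNormal A t y) hinf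
  have hrange : ∀ t y, ¬ IsNormal A t y → -2 ≤ y := by
    intro t y hy
    by_contra hlt
    refine hy (Or.inl ⟨1, one_pos, fun s w _ hw hAw => ?_⟩)
    linarith [(hbd s w hAw).1, (abs_lt.1 hw).2]
  let β : M → M := fun t => OMin.the fun y => (∀ y', ¬ IsNormal A t y' → y ≤ y') ∧
    ∀ u, (∀ y', ¬ IsNormal A t y' → u ≤ y') → u ≤ y
  have hβ : ∀ t, a < t → t < b → ¬ IsNormal A t (β t) := by
    intro t ht1 ht2
    obtain ⟨y0, hy0⟩ := h1 t ht1 ht2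
    obtain ⟨m, hm1, hm2⟩ := h.exists_isLUB (fun u => ∀ y', ¬ IsNormal A t y' → u ≤ y')
      inferInstance ⟨-2, hrange t⟩ ⟨y0, fun u hu => hu y0 hy0⟩
    have hm : ∀ y', ¬ IsNormal A t y' → m ≤ y' := fun y' hy' => hm2 y' fun u hu => hu y' hy'
    have hβm : β t = m := the_eq ⟨hm, hm1⟩ fun y hy => le_antisymm (hm1 y hy.1) (hy.2 m hm)
    rw [hβm]
    intro hn
    obtain ⟨η, hη, h2⟩ := hn.eventually
    have : m + η / 2 ≤ m := hm1 _ fun y' hy' => by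
      by_contra hlt
      refine hy' (h2 y' ?_)
      rw [abs_lt]
      constructor <;> linarith [hm y' hy', not_le.1 hlt]
    linarith
  obtain ⟨a1, b1, ha1, hab1, hb1, η, hη, h2⟩ := h.exists_uniform
    (fun η t => ∀ w, A t w → w ≠ β t → η ≤ |w - β t|)
    (fun η η' t hle h3 w h4 h5 => hle.trans (h3 w h4 h5)) hab (fun t _ _ => by
      obtain ⟨η, hη, h3⟩ := exists_pos_forall_of_finite (hfin t)
        (fun η w => w ≠ β t → η ≤ |w - β t|)
        (fun η η' y' hle h1 h2 => hle.trans (h1 h2))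
        (fun w _ => by
          by_cases hyy : w = β t
          · exact ⟨1, one_pos, fun h => absurd hyy h⟩
          · exact ⟨|w - β t|, abs_pos.2 (sub_ne_zero.2 hyy), fun _ => le_rfl⟩)
      exact ⟨η, hη, fun w hw => h3 w hw⟩)
  obtain ⟨a2, b2, ha2, hab2, hb2, h3⟩ := h.exists_contAt β hab1
  obtain ⟨a3, b3, ha3, hab3, hb3, h4⟩ := h.exists_subinterval (fun t => A t (β t)) hab2
  obtain ⟨t, ht1, ht2⟩ := exists_between hab3
  have hct := h3 t (ha3.trans_lt ht1) (ht2.trans_le hb3)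
  obtain ⟨δ, hδ, h5⟩ := hct (η / 2) (by positivity)
  refine hβ t ((ha1.trans (ha2.trans ha3)).trans_lt ht1) (ht2.trans_le (hb3.trans (hb2.trans hb1))) ?_
  have hρ : 0 < min δ (min (t - a3) (b3 - t)) :=
    lt_min hδ (lt_min (sub_pos.2 ht1) (sub_pos.2 ht2))
  set ρ := min δ (min (t - a3) (b3 - t)) with hρdef
  have hmem : ∀ s, |s - t| < ρ → a3 < s ∧ s < b3 ∧ |β s - β t| < η / 2 := by
    intro s hs
    simp only [hρdef, lt_min_iff] at hs
    exact ⟨by linarith [(abs_lt.1 hs.2.1).1], by linarith [(abs_lt.1 hs.2.2).2], h5 s hs.1⟩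
  have honly : ∀ s w, |s - t| < ρ → |w - β t| < η / 2 → A s w → w = β s := by
    intro s w hs hw hAw
    by_contra hne
    obtain ⟨h6, h7, h8⟩ := hmem s hs
    have h9 := h2 s ((ha2.trans ha3).trans_lt h6) (h7.trans_le (hb3.trans hb2)) w hAw hne
    have h10 : |w - β s| ≤ |w - β t| + |β s - β t| := by
      calc |w - β s| = |(w - β t) - (β s - β t)| := by ring_nf
        _ ≤ _ := abs_sub _ _
    linarith
  rcases h4 with h4 | h4
  · refine Or.inr ⟨h4 t ht1 ht2, ⟨min ρ (η / 2), lt_min hρ (by positivity),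
      fun s w w' hs hw hw' hAw hAw' => ?_⟩, fun ε hε => ?_⟩
    · rw [lt_min_iff] at hs hw hw'
      rw [honly s w hs.1 hw.2 hAw, honly s w' hs.1 hw'.2 hAw']
    · obtain ⟨δ', hδ', h6⟩ := hct ε hε
      refine ⟨min ρ δ', lt_min hρ hδ', fun s hs => ?_⟩
      rw [lt_min_iff] at hs
      obtain ⟨h7, h8, _⟩ := hmem s hs.1
      exact ⟨β s, h6 s hs.2, h4 s h7 h8⟩
  · refine Or.inl ⟨min ρ (η / 2), lt_min hρ (by positivity), fun s w hs hw hAw => ?_⟩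
    rw [lt_min_iff] at hs hw
    obtain ⟨h7, h8, _⟩ := hmem s hs.1
    refine h4 s h7 h8 ?_
    rw [← honly s w hs.1 hw.2 hAw]
    exact hAw

/-- The number of points of `A` above `t` is constant on an interval that carries only normal
points, by definable connectedness. -/
theorem ncard_eq_of_normal {c d : M} (hcd : ∀ t, c < t → t < d → ∀ y, IsNormal A t y) {s t : M}
    (hs1 : c < s) (hs2 : s < d) (ht1 : c < t) (ht2 : t < d) :
    {y | A s y}.ncard = {y | A t y}.ncard := by
  have key : ∀ n s t, c < s → s ≤ t → t < d → (n ≤ {y | A s y}.ncard ↔ n ≤ {y | A t y}.ncard) := by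
    intro n s t h1 h2 h3
    have hdef : DefP L (univ : Set M) (fun τ => n ≤ {y | A τ y}.ncard) :=
      DefP.congr (P := fun τ => ∃ v : Fin n → M, (∀ i j, v i = v j → i = j) ∧ ∀ i, A τ (v i))
        inferInstance fun τ => (le_ncard_iff (hfin τ) n).symm
    by_contra hne
    obtain ⟨τ, h4, h5, h6⟩ := h.exists_bdry (P := fun τ => n ≤ {y | A τ y}.ncard) h2 hne
    obtain ⟨δ, hδ, h7⟩ := h.ncard_eventually_eq A hfin hbd
      (hcd τ (h1.trans_le h4) (h5.trans_lt h3))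
    obtain ⟨⟨s1, h8, h9, h10⟩, ⟨s2, h11, h12, h13⟩⟩ :=
      h6 (τ - δ) (τ + δ) (by linarith) (by linarith)
    rw [h7 s1 (by rw [abs_lt]; constructor <;> linarith)] at h10
    change ¬ n ≤ _ at h13
    rw [h7 s2 (by rw [abs_lt]; constructor <;> linarith)] at h13
    exact h13 h10
  rcases le_total s t with hst | hst
  · exact le_antisymm ((key _ s t hs1 hst ht2).1 le_rfl) ((key _ s t hs1 hst ht2).2 le_rfl)
  · exact le_antisymm ((key _ t s ht1 hst hs2).2 le_rfl) ((key _ t s ht1 hst hs2).1 le_rfl)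

end Tame
end UniformFiniteness

section UniformBounds

variable {L : FirstOrder.Language.{u, v}} {M : Type w} [L.Structure M]
  [OrderedRingLanguage L] [Field M] [LinearOrder M] [IsStrictOrderedRing M]
  [OrderedFieldExpansion L M]

variable (L M) in
/-- Definable families of finite subsets of `M` that are indexed by `X` are uniformly finite. -/
def UniformlyFinite (X : Type w) [TupleSpace M X] : Prop :=
  ∀ P : X → M → Prop, DefP L (univ : Set M) (fun z : X × M => P z.1 z.2) →
    (∀ x, {t | P x t}.Finite) → ∃ N : ℕ, ∀ x, {t | P x t}.ncard ≤ N

/-- It suffices to bound families of subsets of the interval `(-1, 1)`, which is definably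
isomorphic to the line. -/
theorem UniformlyFinite.of_bounded {X : Type w} [TupleSpace M X]
    (hX : ∀ P : X → M → Prop, DefP L (univ : Set M) (fun z : X × M => P z.1 z.2) →
      (∀ x, {t | P x t}.Finite) → (∀ x t, P x t → -1 < t ∧ t < 1) →
      ∃ N : ℕ, ∀ x, {t | P x t}.ncard ≤ N) : UniformlyFinite L M X := by
  intro P hP hfin
  have henc : ∀ w y : M, y * (1 + |w|) = w ↔ y = w / (1 + |w|) := fun w y => by
    rw [eq_div_iff (by positivity)]
  have hinj : Function.Injective (fun w : M => w / (1 + |w|)) := by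
    intro w w' hww
    have h1 : 0 < 1 + |w| := by positivity
    have h2 : 0 < 1 + |w'| := by positivity
    rw [div_eq_div_iff h1.ne' h2.ne'] at hww
    rcases le_total 0 w with h3 | h3 <;> rcases le_total 0 w' with h4 | h4
    · rw [abs_of_nonneg h3, abs_of_nonneg h4] at hww; linarith
    · rw [abs_of_nonneg h3, abs_of_nonpos h4] at hww; nlinarith
    · rw [abs_of_nonpos h3, abs_of_nonneg h4] at hww; nlinarith
    · rw [abs_of_nonpos h3, abs_of_nonpos h4] at hww; linarith
  have himg : ∀ x, {y | ∃ w, P x w ∧ y * (1 + |w|) = w} =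
      (fun w : M => w / (1 + |w|)) '' {t | P x t} := by
    intro x
    ext y
    simp only [henc, mem_ofPred_eq, mem_image, eq_comm]
  obtain ⟨N, hN⟩ := hX (fun x y => ∃ w, P x w ∧ y * (1 + |w|) = w) inferInstance
    (fun x => by rw [himg]; exact (hfin x).image _) (by
      rintro x y ⟨w, _, hw⟩
      rw [henc] at hw
      have h1 : 0 < 1 + |w| := by positivity
      rw [hw, lt_div_iff₀ h1, div_lt_iff₀ h1]
      constructor <;> linarith [neg_abs_le w, le_abs_self w])
  refine ⟨N, fun x => ?_⟩
  have := hN x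
  rwa [himg, ncard_image_of_injective _ hinj] at this

/-- One more parameter `t`: the number of points is constant, as a function of `t`, between
consecutive elements of the finite set of those `t` that carry a point which is not normal.
Hence its maximum is attained on a finite set of `t` that is definable uniformly in `x`. -/
theorem UniformlyFinite.prod (h : Tame L M) {X : Type w} [TupleSpace M X]
    (hX : UniformlyFinite L M X) : UniformlyFinite L M (X × M) := by
  refine UniformlyFinite.of_bounded fun P hP hfin hbd => ?_
  let Bad : X → M → Prop := fun x t => ∃ y, ¬ IsNormal (fun s w => P (x, s) w) t y
  have hBadfin : ∀ x, {t | Bad x t}.Finite := fun x =>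
    h.finite_not_normal (fun s w => P (x, s) w) (fun t => hfin (x, t)) (fun t => hbd (x, t))
  -- a finite set that meets each component of the complement of `Bad x`: the elements and the
  -- midpoints of pairs of elements of `Bad x`, their shifts by `1` for the unbounded components,
  -- and `0` in case `Bad x` is empty
  let D : X → M → Prop := fun x t => t = 0 ∨ ∃ b b', Bad x b ∧ Bad x b' ∧
    (t = b ∨ t + t = b + b' ∨ t = b + 1 ∨ t = b - 1)
  have hDfin : ∀ x, {t | D x t}.Finite := by
    intro x
    have h1 : ({0} ∪ ⋃ b ∈ {t | Bad x t}, ⋃ b' ∈ {t | Bad x t},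
        ({b, (b + b') / 2, b + 1, b - 1} : Set M)).Finite :=
      (finite_singleton _).union ((hBadfin x).biUnion fun b _ => (hBadfin x).biUnion fun b' _ => by
        simp)
    refine h1.subset ?_
    rintro t (rfl | ⟨b, b', hb, hb', h2⟩)
    · exact Or.inl rfl
    · refine Or.inr (mem_biUnion hb (mem_biUnion hb' ?_))
      simp only [mem_insert_iff, mem_singleton_iff]
      rcases h2 with h2 | h2 | h2 | h2
      · exact Or.inl h2
      · exact Or.inr (Or.inl (by linarith))
      · exact Or.inr (Or.inr (Or.inl h2))
      · exact Or.inr (Or.inr (Or.inr h2))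
  have hQfin : ∀ x, {y | ∃ t, D x t ∧ P (x, t) y}.Finite := by
    intro x
    refine ((hDfin x).biUnion fun t _ => hfin (x, t)).subset ?_
    rintro y ⟨t, ht, hy⟩
    exact mem_biUnion (x := t) ht hy
  obtain ⟨N, hN⟩ := hX (fun x y => ∃ t, D x t ∧ P (x, t) y) inferInstance hQfin
  refine ⟨N, ?_⟩
  rintro ⟨x, t⟩
  suffices ∃ t', D x t' ∧ {y | P (x, t) y}.ncard = {y | P (x, t') y}.ncard by
    obtain ⟨t', ht', h1⟩ := this
    rw [h1]
    exact (ncard_le_ncard (fun y hy => (⟨t', ht', hy⟩ : ∃ t, D x t ∧ P (x, t) y))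
      (hQfin x)).trans (hN x)
  by_cases hbad : Bad x t
  · exact ⟨t, Or.inr ⟨t, t, hbad, hbad, Or.inl rfl⟩, rfl⟩
  have key : ∀ c d t', (∀ b, Bad x b → b ≤ c ∨ d ≤ b) → c < t → t < d → c < t' → t' < d → D x t' →
      ∃ t', D x t' ∧ {y | P (x, t) y}.ncard = {y | P (x, t') y}.ncard := by
    intro c d t' h1 h2 h3 h4 h5 h6
    refine ⟨t', h6, h.ncard_eq_of_normal (fun s w => P (x, s) w) (fun t => hfin (x, t))
      (fun t => hbd (x, t)) (c := c) (d := d) ?_ h2 h3 h4 h5⟩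
    intro s hs1 hs2 y
    by_contra hy
    rcases h1 s ⟨y, hy⟩ with h7 | h7
    · exact h7.not_gt hs1
    · exact h7.not_gt hs2
  have hne : ∀ b, Bad x b → b < t ∨ t < b := fun b hb =>
    lt_or_gt_of_ne fun hbt => hbad (hbt ▸ hb)
  have hlow : (∃ c, Bad x c ∧ c < t ∧ ∀ b, Bad x b → b < t → b ≤ c) ∨ ∀ b, Bad x b → t < b := by
    by_cases hemp : {b | Bad x b ∧ b < t}.Nonempty
    · obtain ⟨c, hc, hmax⟩ := Set.exists_max_image _ (fun b => b)
        ((hBadfin x).subset (fun b hb => hb.1 : {b | Bad x b ∧ b < t} ⊆ {b | Bad x b})) hemp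
      exact Or.inl ⟨c, hc.1, hc.2, fun b hb hbt => hmax b ⟨hb, hbt⟩⟩
    · exact Or.inr fun b hb => (hne b hb).resolve_left fun hbt => hemp ⟨b, hb, hbt⟩
  have hhigh : (∃ c, Bad x c ∧ t < c ∧ ∀ b, Bad x b → t < b → c ≤ b) ∨ ∀ b, Bad x b → b < t := by
    by_cases hemp : {b | Bad x b ∧ t < b}.Nonempty
    · obtain ⟨c, hc, hmax⟩ := Set.exists_min_image _ (fun b => b)
        ((hBadfin x).subset (fun b hb => hb.1 : {b | Bad x b ∧ t < b} ⊆ {b | Bad x b})) hemp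
      exact Or.inl ⟨c, hc.1, hc.2, fun b hb hbt => hmax b ⟨hb, hbt⟩⟩
    · exact Or.inr fun b hb => (hne b hb).resolve_right fun hbt => hemp ⟨b, hb, hbt⟩
  rcases hlow with ⟨c, hc, hct, hcmax⟩ | hlow <;> rcases hhigh with ⟨d, hd, htd, hdmin⟩ | hhigh
  · refine key c d ((c + d) / 2) (fun b hb => ?_) hct htd (by linarith) (by linarith)
      (Or.inr ⟨c, d, hc, hd, Or.inr (Or.inl (by ring))⟩)
    rcases hne b hb with h1 | h1
    · exact Or.inl (hcmax b hb h1)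
    · exact Or.inr (hdmin b hb h1)
  · refine key c (max (t + 1) (c + 2)) (c + 1) (fun b hb => Or.inl (hcmax b hb (hhigh b hb))) hct
      (lt_max_of_lt_left (by linarith)) (by linarith) (lt_max_of_lt_right (by linarith))
      (Or.inr ⟨c, c, hc, hc, Or.inr (Or.inr (Or.inl rfl))⟩)
  · refine key (min (t - 1) (d - 2)) d (d - 1) (fun b hb => Or.inr (hdmin b hb (hlow b hb)))
      (min_lt_of_left_lt (by linarith)) htd (min_lt_of_right_lt (by linarith)) (by linarith)
      (Or.inr ⟨d, d, hd, hd, Or.inr (Or.inr (Or.inr rfl))⟩)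
  · refine key (min (t - 1) (-1)) (max (t + 1) 1) 0
      (fun b hb => absurd (hlow b hb) (hhigh b hb).not_gt)
      (min_lt_of_left_lt (by linarith)) (lt_max_of_lt_left (by linarith))
      (min_lt_of_right_lt (by linarith)) (lt_max_of_lt_right (by linarith)) (Or.inl rfl)

theorem Tame.uniformlyFinite (h : Tame L M) (n : ℕ) : UniformlyFinite L M (Fin n → M) := by
  induction n with
  | zero =>
    intro P _ _
    exact ⟨_, fun x => by rw [Subsingleton.elim x 0]⟩
  | succ n ih =>
    intro P hP hfin
    obtain ⟨N, hN⟩ := ih.prod h (fun z t => P (Fin.cons z.2 z.1) t) inferInstance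
      fun z => hfin _
    exact ⟨N, fun x => by simpa using hN (Fin.tail x, x 0)⟩

end UniformBounds

/-! ### Transfer to elementarily equivalent structures -/

section Transfer

variable {L : FirstOrder.Language.{u, v}} [OrderedRingLanguage L]

/-- The formula `s ≤ t`. -/
def leF {α : Type} (s t : L.Term α) : L.Formula α := leSymb.formula₂ s t

/-- The formula in `(y, u)` saying that `u` is an upper bound of `φ(y, -)`. -/
noncomputable def ubF {n : ℕ} (φ : L.Formula (Fin n ⊕ Unit)) : L.Formula (Fin n ⊕ Unit) :=
  ((φ.relabel (Sum.map Sum.inl id)).imp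
    (leF (Term.var (Sum.inr ())) (Term.var (Sum.inl (Sum.inr ())))) :
      L.Formula ((Fin n ⊕ Unit) ⊕ Unit)).iAlls Unit

/-- The formula in `(y, s)` saying that `s` is the least upper bound of `φ(y, -)`. -/
noncomputable def lubF {n : ℕ} (φ : L.Formula (Fin n ⊕ Unit)) : L.Formula (Fin n ⊕ Unit) :=
  ubF φ ⊓ (((ubF φ).relabel (Sum.map Sum.inl id)).imp
    (leF (Term.var (Sum.inl (Sum.inr ()))) (Term.var (Sum.inr ()))) :
      L.Formula ((Fin n ⊕ Unit) ⊕ Unit)).iAlls Unit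

/-- The sentence saying that all the sets `φ(y, -)` that are nonempty and bounded above have a
least upper bound. -/
noncomputable def completeS {n : ℕ} (φ : L.Formula (Fin n ⊕ Unit)) : L.Sentence :=
  (((φ.iExs Unit).imp ((((ubF φ).iExs Unit)).imp ((lubF φ).iExs Unit)) :
    L.Formula (Fin n)).relabel (Sum.inr : Fin n → Empty ⊕ Fin n)).iAlls (Fin n)

/-- The formula in `(y, u, w)` saying that the interval `(u, w)` meets `φ(y, -)`. -/
noncomputable def meetsF {n : ℕ} (φ : L.Formula (Fin n ⊕ Unit)) :
    L.Formula ((Fin n ⊕ Unit) ⊕ Fin 2) :=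
  (∼(leF (Term.var (Sum.inr ())) (Term.var (Sum.inl (Sum.inr 0)))) ⊓
    (∼(leF (Term.var (Sum.inl (Sum.inr 1))) (Term.var (Sum.inr ()))) ⊓
    φ.relabel (Sum.map (fun i => Sum.inl (Sum.inl i)) id)) :
      L.Formula (((Fin n ⊕ Unit) ⊕ Fin 2) ⊕ Unit)).iExs Unit

/-- The formula in `(y, t)` saying that `t` is a boundary point of `φ(y, -)`. -/
noncomputable def bdryF {n : ℕ} (φ : L.Formula (Fin n ⊕ Unit)) : L.Formula (Fin n ⊕ Unit) :=
  Formula.iAlls (Fin 2)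
    (Formula.imp (Formula.not (leF (Term.var (Sum.inl (Sum.inr ()))) (Term.var (Sum.inr 0))))
      (Formula.imp (Formula.not (leF (Term.var (Sum.inr 1)) (Term.var (Sum.inl (Sum.inr ())))))
        (meetsF φ ⊓ meetsF (Formula.not φ))))

/-- The sentence saying that no set `φ(y, -)` contains `N + 1` distinct elements. -/
noncomputable def cardLeS {n : ℕ} (φ : L.Formula (Fin n ⊕ Unit)) (N : ℕ) : L.Sentence :=
  Formula.iAlls (Fin n) (Formula.relabel (Sum.inr : Fin n → Empty ⊕ Fin n)
    (Formula.not (Formula.iExs (Fin (N + 1))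
      (Formula.iInf (fun p : Fin (N + 1) × Fin (N + 1) =>
        ((Term.var (Sum.inr p.1)).equal (Term.var (Sum.inr p.2))).imp
          (if p.1 = p.2 then ⊤ else ⊥)) ⊓
      Formula.iInf (fun i : Fin (N + 1) => φ.relabel (Sum.map id (fun _ => i)))))))

section Realize

variable {M : Type w} [LinearOrder M] [L.Structure M] [L.OrderedStructure M]

theorem realize_leF {α : Type} (s t : L.Term α) (v : α → M) :
    (leF s t).Realize v ↔ s.realize v ≤ t.realize v := by
  simp [leF, Formula.realize_rel₂]

theorem realize_ubF {n : ℕ} (φ : L.Formula (Fin n ⊕ Unit)) (y : Fin n → M) (u : Unit → M) :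
    (ubF φ).Realize (Sum.elim y u) ↔
      ∀ t, φ.Realize (Sum.elim y fun _ => t) → t ≤ u () := by
  simp only [ubF, Formula.realize_iAlls, Formula.realize_imp, Formula.realize_relabel,
    realize_leF, Term.realize_var, Sum.elim_inr, Sum.elim_inl, Sum.elim_comp_map,
    Sum.elim_comp_inl, Function.comp_id]
  exact ⟨fun h t => h fun _ => t, fun h i => h (i ())⟩

theorem realize_lubF {n : ℕ} (φ : L.Formula (Fin n ⊕ Unit)) (y : Fin n → M) (u : Unit → M) :
    (lubF φ).Realize (Sum.elim y u) ↔
      (∀ t, φ.Realize (Sum.elim y fun _ => t) → t ≤ u ()) ∧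
      ∀ u', (∀ t, φ.Realize (Sum.elim y fun _ => t) → t ≤ u') → u () ≤ u' := by
  simp only [lubF, Formula.realize_inf, realize_ubF, Formula.realize_iAlls, Formula.realize_imp,
    Formula.realize_relabel,
    realize_leF, Term.realize_var, Sum.elim_inr, Sum.elim_inl, Sum.elim_comp_map,
    Sum.elim_comp_inl, Function.comp_id]
  exact and_congr_right fun _ => ⟨fun h t => h fun _ => t, fun h i => h (i ())⟩

theorem realize_completeS {n : ℕ} (φ : L.Formula (Fin n ⊕ Unit)) :
    M ⊨ completeS φ ↔ ∀ y : Fin n → M, (∃ t, φ.Realize (Sum.elim y fun _ => t)) →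
      (∃ u, ∀ t, φ.Realize (Sum.elim y fun _ => t) → t ≤ u) →
      ∃ s, (∀ t, φ.Realize (Sum.elim y fun _ => t) → t ≤ s) ∧
      ∀ u, (∀ t, φ.Realize (Sum.elim y fun _ => t) → t ≤ u) → s ≤ u := by
  have hU : ∀ p : (Unit → M) → Prop, (∃ i, p i) ↔ ∃ t, p fun _ => t := fun p =>
    ⟨fun ⟨i, hi⟩ => ⟨i (), hi⟩, fun ⟨t, ht⟩ => ⟨_, ht⟩⟩
  simp only [completeS, Sentence.Realize, Formula.realize_iAlls, Formula.realize_imp,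
    Formula.realize_relabel, Formula.realize_iExs, realize_ubF, realize_lubF, Sum.elim_comp_inr, hU]

theorem realize_meetsF {n : ℕ} (φ : L.Formula (Fin n ⊕ Unit)) (y : Fin n → M) (t : Unit → M)
    (p : Fin 2 → M) : (meetsF φ).Realize (Sum.elim (Sum.elim y t) p) ↔
      ∃ s, p 0 < s ∧ s < p 1 ∧ φ.Realize (Sum.elim y fun _ => s) := by
  have hU : ∀ p : (Unit → M) → Prop, (∃ i, p i) ↔ ∃ t, p fun _ => t := fun p =>
    ⟨fun ⟨i, hi⟩ => ⟨i (), hi⟩, fun ⟨t, ht⟩ => ⟨_, ht⟩⟩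
  simp only [meetsF, Formula.realize_iExs, Formula.realize_inf, Formula.realize_not,
    Formula.realize_relabel, realize_leF, Term.realize_var, Sum.elim_inr, Sum.elim_inl,
    Sum.elim_comp_map, Function.comp_id, not_le, hU]
  rfl

theorem realize_bdryF {n : ℕ} (φ : L.Formula (Fin n ⊕ Unit)) (y : Fin n → M) (t : M) :
    (bdryF φ).Realize (Sum.elim y fun _ => t) ↔
      IsBdry (fun s => φ.Realize (Sum.elim y fun _ => s)) t := by
  simp only [bdryF, Formula.realize_iAlls, Formula.realize_imp, Formula.realize_not,
    Formula.realize_inf, realize_meetsF, realize_leF, Term.realize_var, Sum.elim_inr,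
    Sum.elim_inl, not_le, IsBdry]
  exact ⟨fun h u w => h ![u, w], fun h p => h (p 0) (p 1)⟩

theorem realize_cardLeS {n : ℕ} (φ : L.Formula (Fin n ⊕ Unit)) (N : ℕ) :
    M ⊨ cardLeS φ N ↔ ∀ y : Fin n → M, ¬ ∃ v : Fin (N + 1) → M, (∀ i j, v i = v j → i = j) ∧
      ∀ i, φ.Realize (Sum.elim y fun _ => v i) := by
  have hite : ∀ (p : Prop) [Decidable p] (v : Fin n ⊕ Fin (N + 1) → M),
      ((if p then ⊤ else ⊥ : L.Formula (Fin n ⊕ Fin (N + 1)))).Realize v ↔ p := by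
    intro p _ v
    split_ifs with hp <;> simp [hp]
  simp only [cardLeS, Sentence.Realize, Formula.realize_iAlls, Formula.realize_imp,
    Formula.realize_relabel, Formula.realize_iExs, Formula.realize_not, Formula.realize_inf,
    Formula.realize_iInf, Formula.realize_equal, Term.realize_var, Sum.elim_inr, hite,
    Sum.elim_comp_inr, Sum.elim_comp_map, Prod.forall, Function.comp_id]
  rfl

end Realize

variable {M : Type w} [LinearOrder M] [L.Structure M]

/-- A definable predicate is given by a formula with finitely many parameters. -/
theorem DefP.exists_formula {X : Type w} [TupleSpace M X] {A : Set M} {P : X → Prop}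
    (hP : DefP L A P) : ∃ (n : ℕ) (a : Fin n → M) (φ : L.Formula (Fin n ⊕ TupleSpace.ι M X)),
      (∀ i, a i ∈ A) ∧ ∀ x, P x ↔ φ.Realize (Sum.elim a (TupleSpace.enc x)) := by
  obtain ⟨A0, hA0, h1⟩ := definable_iff_finitely_definable.1 hP.out
  obtain ⟨ψ, hψ⟩ := definable_iff_exists_formula_sum.1 h1
  let e : (A0 : Set M) ≃ Fin (A0.card) := A0.equivFin
  refine ⟨_, fun i => (e.symm i : M), ψ.relabel (Sum.map e id), fun i => hA0 (e.symm i).2,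
    fun x => ?_⟩
  have := Set.ext_iff.1 hψ (TupleSpace.enc x)
  simp only [mem_ofPred_eq, Equiv.symm_apply_apply] at this
  rw [this, Formula.realize_relabel, Sum.elim_comp_map]
  have : (fun i => (e.symm i : M)) ∘ e = (fun x : (A0 : Set M) => (x : M)) := by ext; simp
  rw [this]
  rfl

theorem DefP.formula {n : ℕ} (φ : L.Formula (Fin n ⊕ Unit)) (A : Set M) :
    DefP L A (fun z : (Fin n → M) × M => φ.Realize (Sum.elim z.1 fun _ => z.2)) := by
  refine ⟨Set.Definable.mono (A := ∅) (empty_definable_iff.2 ⟨φ, ?_⟩) (empty_subset _)⟩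
  ext v
  simp only [mem_ofPred_eq]
  have : v = Sum.elim (TupleSpace.enc (M := M) (X := (Fin n → M) × M).symm v).1
      (fun _ => (TupleSpace.enc (M := M) (X := (Fin n → M) × M).symm v).2) := by
    ext (i | i) <;> rfl
  conv_rhs => rw [this]
  exact Iff.rfl

theorem DefP.formula_section {n : ℕ} (φ : L.Formula (Fin n ⊕ Unit)) (y : Fin n → M) :
    DefP L (univ : Set M) (fun t : M => φ.Realize (Sum.elim y fun _ => t)) :=
  DefP.section (P := fun (y : Fin n → M) t => φ.Realize (Sum.elim y fun _ => t)) y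
    (hP := DefP.formula φ univ)

/-- The conditions that define `Tame` are first-order, thanks to uniform finiteness. -/
theorem Tame.transfer [Field M] [IsStrictOrderedRing M] [OrderedFieldExpansion L M]
    (h : Tame L M) {K : Type w'} [LinearOrder K] [L.Structure K] [L.OrderedStructure K]
    (hMK : ∀ φ : L.Sentence, M ⊨ φ ↔ K ⊨ φ) : Tame L K := by
  constructor
  · intro P hP
    obtain ⟨n, a, (φ : L.Formula (Fin n ⊕ Unit)), _, hφ⟩ := hP.exists_formula
    have h1 : K ⊨ completeS (L := L) φ := (hMK _).1 ((realize_completeS φ).2 fun y h1 h2 =>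
      h.exists_isLUB (fun t => φ.Realize (Sum.elim y fun _ => t))
        (DefP.formula_section φ y) h1 h2)
    have h2 := (realize_completeS φ).1 h1 a
    have h3 : ∀ t, P t ↔ φ.Realize (Sum.elim a fun _ => t) := hφ
    simpa only [← h3] using h2
  · intro P hP
    obtain ⟨n, a, (φ : L.Formula (Fin n ⊕ Unit)), _, hφ⟩ := hP.exists_formula
    have h3 : ∀ t, P t ↔ φ.Realize (Sum.elim a fun _ => t) := hφ
    have hfin : ∀ y : Fin n → M, {t | (bdryF φ).Realize (Sum.elim y fun _ => t)}.Finite := by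
      intro y
      simp only [realize_bdryF]
      exact h.finite_bdry _ (DefP.formula_section φ y)
    obtain ⟨N, hN⟩ := h.uniformlyFinite n
      (fun y t => (bdryF φ).Realize (Sum.elim y fun _ => t)) (DefP.formula _ _) hfin
    have h1 : K ⊨ cardLeS (bdryF (L := L) φ) N := (hMK _).1 ((realize_cardLeS _ N).2 fun y hy =>
      absurd ((le_ncard_iff (hfin y) _).2 hy) (Nat.not_le.2 (Nat.lt_succ_of_le (hN y))))
    have h2 := (realize_cardLeS _ N).1 h1 a
    by_contra hinf
    apply h2
    obtain ⟨T, hT, hTcard⟩ := Set.Infinite.exists_subset_card_eq hinf (N + 1)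
    obtain ⟨v, hv, hvT⟩ := (le_ncard_iff T.finite_toSet (N + 1)).1
      (by rw [ncard_coe_finset, hTcard])
    refine ⟨v, hv, fun i => ?_⟩
    rw [realize_bdryF]
    have h4 : IsBdry P (v i) := hT (hvT i)
    have h5 : P = fun s => φ.Realize (Sum.elim a fun _ => s) := funext fun t => propext (h3 t)
    rwa [h5] at h4

end Transfer

/-! ### Definable functions near generic points -/

section Generic

variable {L : FirstOrder.Language.{u, v}} {M : Type w} [L.Structure M]
  [OrderedRingLanguage L] [Field M] [LinearOrder M] [IsStrictOrderedRing M]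
  [OrderedFieldExpansion L M] {A : Set M}

theorem mem_dcl_iff {b : M} : b ∈ dcl L A ↔ DefP L A (fun t : M => t = b) :=
  ⟨fun h => defP_of_definable₁ h, fun h => definable₁_of_defP h⟩

theorem dcl_mono {B : Set M} (h : A ⊆ B) : dcl L A ⊆ dcl L B := fun _ hb =>
  mem_dcl_iff.2 ((mem_dcl_iff.1 hb).mono h)

/-- The elements of a finite definable set are definable, as its `i`-th element in the order. -/
theorem mem_dcl_of_finite {P : M → Prop} [hP : DefP L A P] (hfin : {t | P t}.Finite) {x : M}
    (hx : P x) : x ∈ dcl L A := by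
  induction hn : {t | P t}.ncard generalizing P with
  | zero =>
    rw [ncard_eq_zero hfin] at hn
    exact absurd (show x ∈ {t | P t} from hx) (by simp [hn])
  | succ n ih =>
    obtain ⟨m, hm, hmin⟩ := Set.exists_min_image _ (fun t => t) hfin ⟨x, hx⟩
    have hmin' : ∀ t, P t → m ≤ t := fun t ht => hmin t ht
    have hmdef : DefP L A (fun t : M => t = m) :=
      DefP.congr (P := fun t => P t ∧ ∀ s, P s → t ≤ s) inferInstance fun t =>
        ⟨fun h => le_antisymm (h.2 m hm) (hmin' t h.1), fun h => h ▸ ⟨hm, hmin'⟩⟩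
    by_cases hxm : x = m
    · rw [hxm]
      exact mem_dcl_iff.2 hmdef
    · have hset : {t | P t ∧ ¬ t = m} = {t | P t} \ {m} := rfl
      refine ih (P := fun t => P t ∧ ¬ t = m) (hfin.subset fun t ht => ht.1) ⟨hx, hxm⟩ ?_
      rw [hset, ncard_sdiff_singleton_of_mem hm, hn]
      rfl

instance DefP.isBdry {X : Type w} [TupleSpace M X] {P : X → M → Prop}
    [DefP L A (fun z : X × M => P z.1 z.2)] {t : X → M} [DefF L A t] :
    DefP L A (fun x => IsBdry (P x) (t x)) := by
  unfold IsBdry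
  infer_instance

/-! The instances `DefP.isBdry_self` and `DefP.contAtN_self` cover the eta-reduced forms, which
instance search does not unify with the general ones. -/

instance DefP.isBdry_self {P : M → Prop} [hP : DefP L A P] : DefP L A (IsBdry P) :=
  DefP.congr (P := fun t => (fun z : M × M => IsBdry P z.2) (t, t))
    (DefP.comp (P := fun z : M × M => IsBdry P z.2)
      (DefP.isBdry (P := fun _ : M × M => P) (t := fun z => z.2)) inferInstance)
    fun _ => Iff.rfl

instance DefP.hasD {X : Type w} [TupleSpace M X] {F : X → M → M}
    [DefF L A (fun z : X × M => F z.1 z.2)] {t d : X → M} [DefF L A t] [DefF L A d] :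
    DefP L A (fun x => HasD (F x) (t x) (d x)) := by
  unfold HasD
  infer_instance

/-- A definable set that contains a point outside `dcl A` is a neighbourhood of it, as boundary
points are in `dcl A`. -/
theorem Tame.eventually_of_notMem_dcl (h : Tame L M) {P : M → Prop} [hP : DefP L A P] {x : M}
    (hx : x ∉ dcl L A) (hPx : P x) : ∃ r, 0 < r ∧ ∀ t, |t - x| < r → P t := by
  have h1 : ¬ IsBdry P x := fun hb =>
    hx (mem_dcl_of_finite (P := fun t => IsBdry P t)
      (h.finite_bdry P (hP.mono (subset_univ _))) hb)
  rw [IsBdry] at h1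
  push Not at h1
  obtain ⟨u, w, hu, hw, h2⟩ := h1
  refine ⟨min (x - u) (w - x), lt_min (sub_pos.2 hu) (sub_pos.2 hw), fun t ht => ?_⟩
  rw [lt_min_iff, abs_lt, abs_lt] at ht
  exact h2 ⟨x, hu, hw, hPx⟩ t (by linarith) (by linarith)

theorem Tame.exists_hasD_of_notMem_dcl (h : Tame L M) (f : M → M) [hf : DefF L A f] {x : M}
    (hx : x ∉ dcl L A) : ∃ d, HasD f x d := by
  by_contra hcon
  obtain ⟨r, hr, h1⟩ := h.eventually_of_notMem_dcl (P := fun t => ¬ ∃ d, HasD f t d) hx hcon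
  have : DefF L (univ : Set M) f := hf.mono (subset_univ _)
  obtain ⟨t, d, h2, h3, h4⟩ := h.exists_hasD f (show x < x + r by linarith)
  exact h1 t (by rw [abs_lt]; constructor <;> linarith) ⟨d, h4⟩

variable (L A) in
/-- No entry of the tuple `a` is definable from `A` and the other entries. -/
def Indep {n : ℕ} (a : Fin n → M) : Prop := ∀ i, a i ∉ dcl L (A ∪ a '' {i}ᶜ)

/-- `S` holds on a box around `a`. -/
def Near {n : ℕ} (a : Fin n → M) (S : (Fin n → M) → Prop) : Prop :=
  ∃ r, 0 < r ∧ ∀ q : Fin n → M, (∀ i, |q i - a i| < r) → S q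

/-- Continuity at a point of a function of several variables. -/
def ContAtN {n : ℕ} (F : (Fin n → M) → M) (a : Fin n → M) : Prop :=
  ∀ ε, 0 < ε → Near a fun q => |F q - F a| < ε

theorem Near.self {n : ℕ} {a : Fin n → M} {S : (Fin n → M) → Prop} (h : Near a S) : S a := by
  obtain ⟨r, hr, h⟩ := h
  exact h a fun i => by simpa using hr

theorem Near.and {n : ℕ} {a : Fin n → M} {S S' : (Fin n → M) → Prop} (h : Near a S)
    (h' : Near a S') : Near a fun q => S q ∧ S' q := by
  obtain ⟨r, hr, h⟩ := h
  obtain ⟨r', hr', h'⟩ := h'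
  exact ⟨min r r', lt_min hr hr', fun q hq => ⟨h q fun i => (hq i).trans_le (min_le_left _ _),
    h' q fun i => (hq i).trans_le (min_le_right _ _)⟩⟩

theorem Near.mono {n : ℕ} {a : Fin n → M} {S S' : (Fin n → M) → Prop} (h : Near a S)
    (hS : ∀ q, S q → S' q) : Near a S' := by
  obtain ⟨r, hr, h⟩ := h
  exact ⟨r, hr, fun q hq => hS q (h q hq)⟩

theorem Near.cons {n : ℕ} {a : M} {a' : Fin n → M} {S : (Fin (n + 1) → M) → Prop} {r : M}
    (hr : 0 < r) (h : Near a' fun q => ∀ t, |t - a| < r → S (Fin.cons t q)) :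
    Near (Fin.cons a a' : Fin (n + 1) → M) S := by
  obtain ⟨r', hr', h⟩ := h
  refine ⟨min r r', lt_min hr hr', fun q hq => ?_⟩
  have h1 := h (Fin.tail q) (fun i => by
    have := (hq i.succ).trans_le (min_le_right _ _)
    simpa [Fin.tail] using this) (q 0) (by
    have := (hq 0).trans_le (min_le_left _ _)
    simpa using this)
  simpa using h1

instance DefP.near {X : Type w} [TupleSpace M X] {n : ℕ} {S : X → (Fin n → M) → Prop}
    [DefP L A (fun z : X × (Fin n → M) => S z.1 z.2)] {a : X → Fin n → M} [DefF L A a] :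
    DefP L A (fun x => Near (a x) (S x)) := by
  unfold Near
  infer_instance

instance DefP.contAtN {X : Type w} [TupleSpace M X] {n : ℕ} {F : X → (Fin n → M) → M}
    [DefF L A (fun z : X × (Fin n → M) => F z.1 z.2)] {a : X → Fin n → M} [DefF L A a] :
    DefP L A (fun x => ContAtN (F x) (a x)) := by
  unfold ContAtN
  infer_instance

instance DefP.contAtN_self {n : ℕ} {F : (Fin n → M) → M} [hF : DefF L A F] :
    DefP L A (ContAtN F) :=
  DefP.congr (P := fun t => (fun z : (Fin n → M) × (Fin n → M) => ContAtN F z.2) (t, t))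
    (DefP.comp (P := fun z : (Fin n → M) × (Fin n → M) => ContAtN F z.2)
      (DefP.contAtN (F := fun _ : (Fin n → M) × (Fin n → M) => F) (a := fun z => z.2))
      inferInstance)
    fun _ => Iff.rfl

/-- If all definable functions are continuous at `a` and `R r` holds at `a` for some `r > 0`,
then for some `r > 0` it holds near `a`, because the supremum of the `r` with `R r p` is a
definable function of `p`. -/
theorem Tame.near_uniform (h : Tame L M) {n : ℕ} {a : Fin n → M}
    (ha : ∀ F : (Fin n → M) → M, DefF L A F → ContAtN F a)
    (R : M → (Fin n → M) → Prop) [hR : DefP L A (fun z : M × (Fin n → M) => R z.1 z.2)]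
    (hanti : ∀ r r' p, r ≤ r' → R r' p → R r p) {r0 : M} (hr0 : 0 < r0) (hRa : R r0 a) :
    ∃ r, 0 < r ∧ Near a (R r) := by
  let Q : (Fin n → M) → M → Prop := fun p r => r ≤ 1 ∧ (r ≤ 0 ∨ R r p)
  let ρ : (Fin n → M) → M := fun p => OMin.the fun d => (∀ r, Q p r → r ≤ d) ∧
    ∀ u, (∀ r, Q p r → r ≤ u) → d ≤ u
  have hQdef : ∀ p, DefP L (univ : Set M) (Q p) := fun p => by
    have := hR.mono (subset_univ _)
    infer_instance
  have hρ : ∀ p, (∀ r, Q p r → r ≤ ρ p) ∧ ∀ u, (∀ r, Q p r → r ≤ u) → ρ p ≤ u := by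
    intro p
    obtain ⟨d, hd1, hd2⟩ := h.exists_isLUB (Q p) (hQdef p) ⟨0, zero_le_one, Or.inl le_rfl⟩
      ⟨1, fun r hr => hr.1⟩
    have : ρ p = d := the_eq ⟨hd1, hd2⟩ fun y hy => le_antisymm (hy.2 d hd1) (hd2 y hy.1)
    rw [this]
    exact ⟨hd1, hd2⟩
  have hpos : 0 < ρ a := (lt_min hr0 one_pos).trans_le
    ((hρ a).1 _ ⟨min_le_right _ _, Or.inr (hanti _ _ _ (min_le_left _ _) hRa)⟩)
  refine ⟨ρ a / 2, by positivity, (ha ρ inferInstance (ρ a / 2) (by positivity)).mono fun p hp => ?_⟩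
  by_contra hcon
  have := (hρ p).2 (ρ a / 2) fun r hr => by
    by_contra hlt
    rcases hr.2 with h1 | h1
    · linarith
    · exact hcon (hanti _ _ _ (not_le.1 hlt).le h1)
  linarith [(abs_lt.1 hp).1]

theorem Indep.tail {n : ℕ} {a : M} {a' : Fin n → M}
    (ha : Indep L A (Fin.cons a a' : Fin (n + 1) → M)) : Indep L (insert a A) a' := by
  intro i hi
  refine ha i.succ (dcl_mono ?_ (by simpa using hi))
  rintro x ((rfl | hx) | ⟨j, hj, rfl⟩)
  · exact Or.inr ⟨0, (Fin.succ_ne_zero i).symm, by simp⟩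
  · exact Or.inl hx
  · exact Or.inr ⟨j.succ, fun hji => hj (Fin.succ_injective _ hji), by simp⟩

theorem Indep.head {n : ℕ} {a : M} {a' : Fin n → M}
    (ha : Indep L A (Fin.cons a a' : Fin (n + 1) → M)) : a ∉ dcl L (A ∪ range a') := by
  intro hi
  refine ha 0 (dcl_mono ?_ (by simpa using hi))
  rintro x (hx | ⟨j, rfl⟩)
  · exact Or.inl hx
  · exact Or.inr ⟨j.succ, Fin.succ_ne_zero j, by simp⟩

/-- At a tuple `a` that is independent over `A`, all `A`-definable functions are continuous and all
`A`-definable sets that contain `a` are neighbourhoods of `a`. In the induction step a function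
`F (t, q)` is continuous in each of `t` and `q`, and monotone in `t` on an interval of fixed length
for all `q` near the tail of `a`. -/
theorem Tame.generic (h : Tame L M) (n : ℕ) : ∀ (A : Set M) (a : Fin n → M), Indep L A a →
    (∀ S : (Fin n → M) → Prop, DefP L A S → S a → Near a S) ∧
      ∀ F : (Fin n → M) → M, DefF L A F → ContAtN F a := by
  induction n with
  | zero =>
    intro A a _
    have : ∀ q : Fin 0 → M, q = a := fun q => Subsingleton.elim _ _
    refine ⟨fun S _ hS => ⟨1, one_pos, fun q _ => this q ▸ hS⟩, fun F _ ε hε =>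
      ⟨1, one_pos, fun q _ => ?_⟩⟩
    rw [this q]
    change |F a - F a| < ε
    rw [sub_self, abs_zero]
    exact hε
  | succ n ih =>
    intro A a
    refine Fin.consCases (fun a a' ha => ?_) a
    obtain ⟨ih1, ih2⟩ := ih _ a' ha.tail
    have hhead := ha.head
    have hA1 : A ⊆ A ∪ range a' := subset_union_left
    have hA2 : A ⊆ insert a A := subset_insert _ _
    have : Param (A ∪ range a') a' := ⟨fun i => Or.inr ⟨i, rfl⟩⟩
    have : Param (insert a A) a := Param.of_mem (mem_insert _ _)
    refine ⟨fun S hS hSa => ?_, fun F hF ε hε => ?_⟩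
    · have hS1 := hS.mono hA1
      have hS2 := hS.mono hA2
      obtain ⟨r0, hr0, h1⟩ := h.eventually_of_notMem_dcl
        (P := fun t => S (Fin.cons t a')) hhead hSa
      obtain ⟨r, hr, h2⟩ := h.near_uniform ih2 (fun r q => ∀ t, |t - a| < r → S (Fin.cons t q))
        (fun r r' q hrr h2 t ht => h2 t (ht.trans_le hrr)) hr0 h1
      exact Near.cons hr h2
    · have key : ∀ F : (Fin (n + 1) → M) → M, DefF L A F →
          (∃ r, 0 < r ∧ ∀ s s', |s - a| < r → |s' - a| < r → s ≤ s' →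
            F (Fin.cons s a') ≤ F (Fin.cons s' a')) →
          Near (Fin.cons a a' : Fin (n + 1) → M)
            fun q => |F q - F (Fin.cons a a' : Fin (n + 1) → M)| < ε := by
        rintro F hF ⟨r0, hr0, hinc⟩
        have hF1 := hF.mono hA1
        have hF2 := hF.mono hA2
        obtain ⟨r1, hr1, h1⟩ := h.near_uniform ih2
          (fun r q => ∀ s s', |s - a| < r → |s' - a| < r → s ≤ s' →
            F (Fin.cons s q) ≤ F (Fin.cons s' q))
          (fun r r' q hrr h2 s s' hs hs' => h2 s s' (hs.trans_le hrr) (hs'.trans_le hrr)) hr0 hinc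
        obtain ⟨d, hd⟩ := h.exists_hasD_of_notMem_dcl (fun t => F (Fin.cons t a')) hhead
        obtain ⟨δ, hδ, h2⟩ := hd.contAt (ε / 2) (by positivity)
        obtain ⟨r2, hr2, h3⟩ := h.eventually_of_notMem_dcl
          (P := fun t => ContAtN (fun q => F (Fin.cons t q)) a') hhead
          (ih2 (fun q => F (Fin.cons a q)) inferInstance)
        set η := min δ (min r1 r2) / 2
        have hη0 : 0 < η := by positivity
        have hηδ : η < δ := by
          have : min δ (min r1 r2) ≤ δ := min_le_left _ _
          simp only [η]; linarith
        have hηr1 : η < r1 := by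
          have : min δ (min r1 r2) ≤ r1 := (min_le_right _ _).trans (min_le_left _ _)
          simp only [η]; linarith
        have hηr2 : η < r2 := by
          have : min δ (min r1 r2) ≤ r2 := (min_le_right _ _).trans (min_le_right _ _)
          simp only [η]; linarith
        have e1 : |a - η - a| = η := by
          rw [sub_right_comm, sub_self, zero_sub, abs_neg, abs_of_pos hη0]
        have e2 : |a + η - a| = η := by rw [add_sub_cancel_left, abs_of_pos hη0]
        have h4 := h3 (a - η) (by rwa [e1]) (ε / 2) (by positivity)
        have h5 := h3 (a + η) (by rwa [e2]) (ε / 2) (by positivity)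
        have h6 := h2 (a - η) (by rwa [e1])
        have h7 := h2 (a + η) (by rwa [e2])
        refine Near.cons hη0 ((h1.and (h4.and h5)).mono fun q hq t ht => ?_)
        obtain ⟨h8, h9, h10⟩ := hq
        have h11 := h8 (a - η) t (by rwa [e1]) (ht.trans hηr1) (by linarith [(abs_lt.1 ht).1])
        have h12 := h8 t (a + η) (ht.trans hηr1) (by rwa [e2]) (by linarith [(abs_lt.1 ht).2])
        rw [abs_lt] at h6 h7 h9 h10 ⊢
        constructor <;> linarith
      have hF1 := hF.mono hA1
      -- by the monotonicity theorem, applied near `a`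
      have hmono : (∃ r, 0 < r ∧ ∀ s s', |s - a| < r → |s' - a| < r → s ≤ s' →
            F (Fin.cons s a') ≤ F (Fin.cons s' a')) ∨
          (∃ r, 0 < r ∧ ∀ s s', |s - a| < r → |s' - a| < r → s ≤ s' →
            F (Fin.cons s' a') ≤ F (Fin.cons s a')) := by
        by_contra hcon
        obtain ⟨r, hr, h1⟩ := h.eventually_of_notMem_dcl (A := A ∪ range a') (P := fun t =>
          ¬ ((∃ r, 0 < r ∧ ∀ s s', |s - t| < r → |s' - t| < r → s ≤ s' →
            F (Fin.cons s a') ≤ F (Fin.cons s' a')) ∨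
          (∃ r, 0 < r ∧ ∀ s s', |s - t| < r → |s' - t| < r → s ≤ s' →
            F (Fin.cons s' a') ≤ F (Fin.cons s a')))) hhead hcon
        have : DefF L (univ : Set M) (fun t => F (Fin.cons t a')) :=
          DefF.mono (A := A ∪ range a') inferInstance (subset_univ _)
        obtain ⟨c, d, h2, h3, h4, h5⟩ := h.exists_monotone (fun t => F (Fin.cons t a'))
          (show a < a + r by linarith)
        obtain ⟨t, ht1, ht2⟩ := exists_between h3
        refine h1 t (by rw [abs_lt]; constructor <;> linarith) ?_
        have hmem : ∀ s, |s - t| < min (t - c) (d - t) → c < s ∧ s < d := fun s hs => by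
          rw [lt_min_iff, abs_lt, abs_lt] at hs
          constructor <;> linarith
        have hpos : 0 < min (t - c) (d - t) := lt_min (sub_pos.2 ht1) (sub_pos.2 ht2)
        rcases h5 with h5 | h5 | h5
        · refine Or.inl ⟨_, hpos, fun s s' hs hs' hss => ?_⟩
          rcases hss.eq_or_lt with rfl | hss
          · exact le_rfl
          · exact (h5 s s' (hmem s hs).1 hss (hmem s' hs').2).le
        · refine Or.inl ⟨_, hpos, fun s s' hs hs' hss => ?_⟩
          rcases hss.eq_or_lt with rfl | hss
          · exact le_rfl
          · exact (h5 s s' (hmem s hs).1 hss (hmem s' hs').2).le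
        · refine Or.inr ⟨_, hpos, fun s s' hs hs' hss => ?_⟩
          rcases hss.eq_or_lt with rfl | hss
          · exact le_rfl
          · exact (h5 s s' (hmem s hs).1 hss (hmem s' hs').2).le
      rcases hmono with h1 | ⟨r, hr, h1⟩
      · exact key F hF h1
      · refine (key (fun q => - F q) inferInstance ⟨r, hr, fun s s' hs hs' hss =>
          neg_le_neg (h1 s s' hs hs' hss)⟩).mono fun q hq => ?_
        rwa [show - F q - - F (Fin.cons a a' : Fin (n + 1) → M) =
          -(F q - F (Fin.cons a a' : Fin (n + 1) → M)) by ring, abs_neg] at hq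

/-- The `i`-th partial derivative of `F`, or `0` where it does not exist. -/
noncomputable def pderiv {n : ℕ} (F : (Fin n → M) → M) (i : Fin n) (p : Fin n → M) : M :=
  OMin.the fun d => HasD (fun t => F (Function.update p i t)) (p i) d

/-- All partial derivatives of `F` exist at `p` and are continuous there. -/
def IsC1At {n : ℕ} (F : (Fin n → M) → M) (p : Fin n → M) : Prop :=
  ∀ i, HasD (fun t => F (Function.update p i t)) (p i) (pderiv F i p) ∧ ContAtN (pderiv F i) p

instance DefF.pderiv {n : ℕ} {F : (Fin n → M) → M} [DefF L A F] (i : Fin n) :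
    DefF L A (OMin.pderiv F i) := by
  unfold OMin.pderiv
  infer_instance

instance DefP.isC1At {n : ℕ} {F : (Fin n → M) → M} [DefF L A F] :
    DefP L A (fun p => IsC1At F p) := by
  unfold IsC1At
  infer_instance

theorem Tame.near_isC1At (h : Tame L M) {n : ℕ} {a : Fin n → M} (ha : Indep L A a)
    (F : (Fin n → M) → M) [hF : DefF L A F] : Near a (IsC1At F) := by
  obtain ⟨h1, h2⟩ := h.generic n A a ha
  refine h1 _ inferInstance fun i => ⟨?_, h2 _ inferInstance⟩
  have hF' := hF.mono (subset_union_left (t := a '' {i}ᶜ))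
  have hupd : DefF L (A ∪ a '' {i}ᶜ) (fun t : M => Function.update a i t) := DefF.pi fun j => by
    by_cases hj : j = i
    · subst hj
      simp only [Function.update_self]
      infer_instance
    · have : Param (A ∪ a '' {i}ᶜ) (a j) := Param.of_mem (Or.inr ⟨j, hj, rfl⟩)
      simp only [Function.update_of_ne hj]
      infer_instance
  obtain ⟨d, hd⟩ := h.exists_hasD_of_notMem_dcl (fun t => F (Function.update a i t)) (ha i)
    (hf := hF'.comp hupd)
  have : OMin.pderiv F i a = d := the_eq hd fun d' hd' => hd'.unique hd
  rw [this]
  exact hd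

end Generic

/-! ### Definable closure -/

section Closure

variable {L : FirstOrder.Language.{u, v}} {M : Type w} [L.Structure M]
  [OrderedRingLanguage L] [Field M] [LinearOrder M] [IsStrictOrderedRing M]
  [OrderedFieldExpansion L M] {A : Set M}

theorem DefF.const_of_mem_dcl {X : Type w} [TupleSpace M X] {b : M} (hb : b ∈ dcl L A) :
    DefF L A (fun _ : X => b) := by
  have := mem_dcl_iff.1 hb
  exact DefF.of_graph (P := fun _ y => y = b)
    (this.comp (f := fun z : X × M => z.2) inferInstance) fun _ _ => Iff.rfl

theorem mem_dcl_of_defF {n : ℕ} (F : (Fin n → M) → M) [hF : DefF L A F] {a : Fin n → M}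
    (ha : ∀ i, a i ∈ dcl L A) : F a ∈ dcl L A := by
  have : DefF L A (fun _ : M => a) := DefF.pi fun i => DefF.const_of_mem_dcl (ha i)
  have := hF.comp this
  exact mem_dcl_iff.2 inferInstance

/-- Elements of `dcl A` are values of parameter-free functions at tuples from `A`. -/
theorem exists_defF_of_mem_dcl {z : M} (hz : z ∈ dcl L A) :
    ∃ (n : ℕ) (a : Fin n → M) (F : (Fin n → M) → M),
      (∀ i, a i ∈ A) ∧ DefF L (∅ : Set M) F ∧ F a = z := by
  obtain ⟨n, a, (φ : L.Formula (Fin n ⊕ Unit)), ha, hφ⟩ := (mem_dcl_iff.1 hz).exists_formula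
  have h3 : ∀ t, t = z ↔ φ.Realize (Sum.elim a fun _ => t) := hφ
  have := DefP.formula φ (∅ : Set M)
  refine ⟨n, a, fun p => OMin.the fun t => φ.Realize (Sum.elim p fun _ => t), ha, inferInstance,
    the_eq ((h3 z).1 rfl) fun y hy => (h3 y).2 hy⟩

theorem subset_dcl : A ⊆ dcl L A := fun b hb => by
  have := Param.of_mem hb
  exact mem_dcl_iff.2 inferInstance

theorem mem_dcl_of_subset_dcl {B : Set M} {z : M} (hz : z ∈ dcl L B) (hB : B ⊆ dcl L A) :
    z ∈ dcl L A := by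
  obtain ⟨n, a, F, ha, hF, rfl⟩ := exists_defF_of_mem_dcl hz
  have := hF.mono (empty_subset A)
  exact mem_dcl_of_defF F fun i => hB (ha i)

/-- Elementary substructures are definably closed. -/
theorem mem_of_mem_dcl (E : L.ElementarySubstructure M) {b : M} (hb : b ∈ dcl L (E : Set M)) :
    b ∈ E := by
  obtain ⟨n, a, (φ : L.Formula (Fin n ⊕ Unit)), ha, hφ⟩ := (mem_dcl_iff.1 hb).exists_formula
  have h3 : ∀ t, t = b ↔ φ.Realize (Sum.elim a fun _ => t) := hφ
  let a' : Fin n → E := fun i => ⟨a i, ha i⟩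
  have h1 : (φ.iExs Unit).Realize (E.subtype ∘ a') :=
    Formula.realize_iExs.2 ⟨fun _ => b, (h3 b).1 rfl⟩
  rw [E.subtype.map_formula, Formula.realize_iExs] at h1
  obtain ⟨t, ht⟩ := h1
  rw [← E.subtype.map_formula, Sum.comp_elim] at ht
  have : (t () : M) = b := (h3 _).2 ht
  exact this ▸ (t ()).2

/-- Every element of `E⟨x⟩` is the value of a parameter-free function at a tuple `(x, e)` with
entries independent over `∅` and `e` from `E`: take `e` of minimal length. -/
theorem IsSimpleExtension.exists_indep {E : L.ElementarySubstructure M} {x : M}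
    (hx : IsSimpleExtension E x) (z : M) : ∃ (n : ℕ) (e : Fin n → M)
      (F : (Fin (n + 1) → M) → M), (∀ i, e i ∈ E) ∧
      Indep L (∅ : Set M) (Fin.cons x e : Fin (n + 1) → M) ∧ DefF L (∅ : Set M) F ∧
      F (Fin.cons x e) = z := by
  let Q : ℕ → Prop := fun n => ∃ e : Fin n → M, (∀ i, e i ∈ E) ∧ z ∈ dcl L (insert x (range e))
  have hQ : ∃ n, Q n := by
    obtain ⟨n, a, F, ha, hF, hFa⟩ := exists_defF_of_mem_dcl (hx.dcl_eq_univ ▸ mem_univ z)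
    have h0 : (0 : M) ∈ E := mem_of_mem_dcl E (mem_dcl_iff.2 inferInstance)
    classical
    refine ⟨n, fun i => if a i ∈ E then a i else 0, fun i => ?_, ?_⟩
    · dsimp only
      split_ifs with h
      · exact h
      · exact h0
    · rw [← hFa]
      have := hF.mono (empty_subset (insert x (range fun i => if a i ∈ E then a i else 0)))
      refine mem_dcl_of_defF F fun i => subset_dcl ?_
      by_cases h : a i ∈ E
      · exact Or.inr ⟨i, by simp [h]⟩
      · exact Or.inl ((ha i).resolve_right h)
  classical
  obtain ⟨e, he, hz⟩ := Nat.find_spec hQ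
  have hmin : ∀ m < Nat.find hQ, ¬ Q m := fun m hm => Nat.find_min hQ hm
  generalize Nat.find hQ = n at e he hz hmin
  obtain ⟨m, b, F, hb, hF, rfl⟩ := exists_defF_of_mem_dcl hz
  have hr : range (Fin.cons x e : Fin (n + 1) → M) = insert x (range e) := by
    rw [Fin.range_cons]
  rw [← hr] at hb
  choose σ hσ using hb
  refine ⟨n, e, fun p => F fun j => p (σ j), he, fun i => ?_, hF.comp (DefF.pi fun j => ?_), by
    simp only [hσ]⟩
  swap
  · infer_instance
  -- `x` is not in `dcl E`; and an entry `e j` definable from the others could be omitted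
  refine Fin.cases (fun h => ?_) (fun j h => ?_) i
  · refine hx.notMem_dcl (dcl_mono ?_ h)
    rintro _ (h | ⟨j, hj, rfl⟩)
    · exact h.elim
    · obtain ⟨k, rfl⟩ := Fin.exists_succ_eq.2 hj
      exact he k
  · obtain ⟨k, rfl⟩ : ∃ k, n = k + 1 := ⟨n - 1, by have := j.pos; omega⟩
    refine hmin k (Nat.lt_succ_self k) ⟨fun i => e (j.succAbove i), fun i => he _,
      mem_dcl_of_subset_dcl hz ?_⟩
    rintro _ (rfl | ⟨i, rfl⟩)
    · exact subset_dcl (mem_insert _ _)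
    · by_cases hij : i = j
      · subst hij
        rw [Fin.cons_succ] at h
        refine dcl_mono ?_ h
        rintro _ (h | ⟨l, hl, rfl⟩)
        · exact h.elim
        · refine Fin.cases (fun _ => mem_insert _ _) (fun l hl => ?_) l hl
          obtain ⟨k', rfl⟩ := Fin.exists_succAbove_eq (x := l) (y := i) fun h => hl (by rw [h]; rfl)
          exact Or.inr ⟨k', rfl⟩
      · obtain ⟨k', rfl⟩ := Fin.exists_succAbove_eq hij
        exact subset_dcl (Or.inr ⟨k', rfl⟩)

end Closure

/-! ### Derivations as derivatives of definable functions -/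

section Derivation

variable {L : FirstOrder.Language.{u, v}} {K : Type w} [L.Structure K]
  [OrderedRingLanguage L] [Field K] [LinearOrder K] [IsStrictOrderedRing K]
  [OrderedFieldExpansion L K] [TopologicalSpace K] [OrderTopology K]

theorem mem_nhds_iff_near {n : ℕ} {a : Fin n → K} {S : (Fin n → K) → Prop} :
    {q | S q} ∈ 𝓝 a ↔ Near a S := by
  rw [nhds_pi]
  constructor
  · intro h
    obtain ⟨I, _, t, ht, hS⟩ := Filter.mem_pi.1 h
    have : ∀ i, ∃ r, 0 < r ∧ ∀ s, |s - a i| < r → s ∈ t i := fun i => by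
      obtain ⟨r, hr, h1⟩ := (nhds_basis_abs_sub_lt (a i)).mem_iff.1 (ht i)
      exact ⟨r, hr, fun s hs => h1 hs⟩
    choose r hr h1 using this
    obtain ⟨ρ, hρ, h2⟩ := exists_pos_forall_of_finite (finite_range r) (fun η y => η ≤ y)
      (fun _ _ _ => le_trans) (by rintro _ ⟨i, rfl⟩; exact ⟨r i, hr i, le_rfl⟩)
    exact ⟨ρ, hρ, fun q hq => hS fun i _ => h1 i _ ((hq i).trans_le (h2 _ ⟨i, rfl⟩))⟩
  · rintro ⟨r, hr, h⟩
    refine Filter.mem_of_superset (Filter.pi_mem_pi Set.finite_univ fun i _ =>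
      (nhds_basis_abs_sub_lt (a i)).mem_of_mem hr) fun q hq => h q fun i => hq i (mem_univ i)

theorem ContAtN.continuousAt {n : ℕ} {F : (Fin n → K) → K} {a : Fin n → K} (h : ContAtN F a) :
    ContinuousAt F a :=
  (nhds_basis_abs_sub_lt (F a)).tendsto_right_iff.2 fun ε hε => mem_nhds_iff_near.2 (h ε hε)

theorem HasD.hasPartialDerivAt {n : ℕ} {F : (Fin n → K) → K} {p : Fin n → K} {i : Fin n} {d : K}
    (h : HasD (fun t => F (Function.update p i t)) (p i) d) : HasPartialDerivAt F i d p := by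
  refine (nhds_basis_abs_sub_lt d).tendsto_right_iff.2 fun ε hε => ?_
  obtain ⟨r, hr, h1⟩ := h (ε / 2) (by positivity)
  rw [eventually_nhdsWithin_iff]
  refine (nhds_basis_abs_sub_lt (0 : K)).mem_iff.2 ⟨r, hr, fun s hs hs0 => ?_⟩
  have hs0 : s ≠ 0 := hs0
  have h2 := h1 (p i + s) (by simpa using hs)
  simp only [add_sub_cancel_left, Function.update_eq_self] at h2
  have hpos : 0 < |s| := abs_pos.2 hs0
  have h3 : (F (Function.update p i (p i + s)) - F p) / s - d =
      (F (Function.update p i (p i + s)) - F p - d * s) / s := by field_simp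
  show |_| < ε
  rw [h3, abs_div, div_lt_iff₀ hpos]
  refine h2.trans_lt ?_
  exact mul_lt_mul_of_pos_right (by linarith) hpos

/-- The chain rule at `a`, for the restriction of `F` to the open definable set of points near which
`F` is continuously differentiable. -/
theorem IsTDerivation.eq_sum {δ : K → K} (hδ : IsTDerivation L δ) {n : ℕ} {a : Fin n → K}
    {F : (Fin n → K) → K} [DefF L (∅ : Set K) F] (h : Near a (IsC1At F)) :
    δ (F a) = ∑ i, pderiv F i a * δ (a i) := by
  have hmem : ∀ p, p ∈ interior {p | IsC1At F p} ↔ Near p (IsC1At F) := fun p => by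
    rw [mem_interior_iff_mem_nhds, mem_nhds_iff_near]
  refine hδ n (interior {p | IsC1At F p}) F (pderiv F) isOpen_interior ?_ (fun i => ⟨fun p hp => ?_,
    fun p hp => ?_⟩) a ((hmem a).2 h)
  · have : DefF L (∅ : Set K) (fun q : Fin (n + 1) → K => (Fin.init q : Fin n → K)) :=
      DefF.pi fun i => by unfold Fin.init; infer_instance
    have h1 : DefP L (∅ : Set K) (fun q : Fin (n + 1) → K =>
      Near (Fin.init q : Fin n → K) (IsC1At F) ∧ q (Fin.last n) = F (Fin.init q)) := inferInstance
    have h2 := h1.out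
    simp only [← hmem] at h2
    exact h2
  · exact (((hmem p).1 hp).self i).1.hasPartialDerivAt
  · exact (((hmem p).1 hp).self i).2.continuousAt.continuousWithinAt

variable {E : L.ElementarySubstructure K} {x : K} {δ : K → K}

theorem IsTDerivation.eq_zero_of_mem (hδ : IsTDerivation L δ) (hE : IsLinearOver (E : Set K) δ)
    {c : K} (hc : c ∈ E) : δ c = 0 := by
  have h1 : δ 1 = 0 := by
    simpa using hδ.eq_sum (a := Fin.elim0) (F := fun _ : Fin 0 → K => (1 : K))
      ⟨1, one_pos, fun q _ i => i.elim0⟩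
  rw [← mul_one c, hE.2 c hc, h1, mul_zero]

/-- Every element `z` of `E⟨x⟩` is `f(x)` for some `E`-definable function `f` with
`f'(x) = δ z`. -/
theorem IsTDerivation.exists_hasD (hK : Tame L K) (hx : IsSimpleExtension E x)
    (hδ : IsTDerivation L δ) (hE : IsLinearOver (E : Set K) δ) (hδx : δ x = 1) (z : K) :
    ∃ f : K → K, DefF L (E : Set K) f ∧ f x = z ∧ HasD f x (δ z) := by
  obtain ⟨n, e, F, he, hind, hF, rfl⟩ := hx.exists_indep z
  have h1 := hK.near_isC1At hind F
  have h2 := hδ.eq_sum h1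
  have h3 : ∀ i, δ (e i) = 0 := fun i => hδ.eq_zero_of_mem hE (he i)
  rw [Fin.sum_univ_succ] at h2
  simp only [Fin.cons_zero, Fin.cons_succ, h3, hδx, mul_zero, Finset.sum_const_zero, add_zero,
    mul_one] at h2
  have h4 := (h1.self 0).1
  simp only [Fin.update_cons_zero, Fin.cons_zero] at h4
  have := hF.mono (empty_subset (E : Set K))
  have : Param (E : Set K) e := ⟨fun i => he i⟩
  exact ⟨fun t => F (Fin.cons t e), inferInstance, rfl, h2 ▸ h4⟩

end Derivation

/-! ### Elements of the base model between elements of the extension -/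

section Between

variable {L : FirstOrder.Language.{u, v}} {K : Type w} [L.Structure K]
  [OrderedRingLanguage L] [Field K] [LinearOrder K] [IsStrictOrderedRing K]
  [OrderedFieldExpansion L K] {A : Set K}

/-- An `A`-definable set that contains `x ∉ dcl A` contains an `A`-definable convex
neighbourhood of `x`: its endpoints are boundary points, hence in `dcl A`. -/
theorem Tame.exists_convex (hK : Tame L K) {x : K} (hx : x ∉ dcl L A) (P : K → Prop)
    [hP : DefP L A P] (hPx : P x) : ∃ C : K → Prop, DefP L A C ∧ C x ∧ (∀ t, C t → P t) ∧
      ∀ s t r, C s → C t → s ≤ r → r ≤ t → C r := by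
  have hPu := hP.mono (subset_univ _)
  have hfin := hK.finite_bdry P hPu
  have hbdcl : ∀ b, IsBdry P b → b ∈ dcl L A := fun b hb => mem_dcl_of_finite hfin hb
  have hdef : ∀ S : Set K, S.Finite → S ⊆ dcl L A →
      DefP L A (fun t => ∀ b ∈ S, b < t) ∧ DefP L A (fun t => ∀ b ∈ S, t < b) := by
    intro S hS
    induction S, hS using Set.Finite.induction_on with
    | empty => exact fun _ => ⟨by simpa using DefP.const True, by simpa using DefP.const True⟩
    | @insert b S _ _ ih =>
      intro hsub
      obtain ⟨h1, h2⟩ := ih ((subset_insert _ _).trans hsub)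
      have : DefF L A (fun _ : K => b) := DefF.const_of_mem_dcl (hsub (mem_insert _ _))
      simp only [forall_mem_insert]
      exact ⟨DefP.and (h1 := DefP.lt) (h2 := h1), DefP.and (h1 := DefP.lt) (h2 := h2)⟩
  have h1 := (hdef {b | IsBdry P b ∧ b < x} (hfin.subset fun b hb => hb.1)
    fun b hb => hbdcl b hb.1).1
  have h2 := (hdef {b | IsBdry P b ∧ x < b} (hfin.subset fun b hb => hb.1)
    fun b hb => hbdcl b hb.1).2
  refine ⟨fun t => (∀ b ∈ {b | IsBdry P b ∧ b < x}, b < t) ∧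
    ∀ b ∈ {b | IsBdry P b ∧ x < b}, t < b, inferInstance,
    ⟨fun b hb => hb.2, fun b hb => hb.2⟩, fun t ht => ?_, fun s t r hs ht hsr hrt =>
      ⟨fun b hb => (hs.1 b hb).trans_le hsr, fun b hb => hrt.trans_lt (ht.2 b hb)⟩⟩
  by_contra hPt
  rcases le_total t x with htx | hxt
  · obtain ⟨b, hb1, hb2, hb⟩ := hK.exists_bdry (P := P) htx (by tauto)
    rcases hb2.eq_or_lt with rfl | hlt
    · exact hx (hbdcl _ hb)
    · exact (ht.1 b ⟨hb, hlt⟩).not_ge hb1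
  · obtain ⟨b, hb1, hb2, hb⟩ := hK.exists_bdry (P := P) hxt (by tauto)
    rcases hb1.eq_or_lt with rfl | hlt
    · exact hx (hbdcl _ hb)
    · exact (ht.2 b ⟨hb, hlt⟩).not_ge hb2

/-- If `f ≤ g` uniformly on a definable set `C`, then `sup f(C)` is definable and separates
the values of `f` and `g` on `C`. -/
theorem Tame.exists_mem_dcl_between (hK : Tame L K) (f g : K → K) [hf : DefF L A f]
    (C : K → Prop) [hC : DefP L A C] {x : K} (hx : C x)
    (hfg : ∀ t t', C t → C t' → f t ≤ g t') : ∃ s ∈ dcl L A, f x ≤ s ∧ s ≤ g x := by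
  have hf' := hf.mono (subset_univ _)
  have hC' := hC.mono (subset_univ _)
  obtain ⟨s, hs1, hs2⟩ := hK.exists_isLUB (fun y => ∃ t, C t ∧ y = f t) inferInstance
    ⟨_, x, hx, rfl⟩ ⟨g x, by rintro _ ⟨t, ht, rfl⟩; exact hfg t x ht hx⟩
  refine ⟨s, mem_dcl_iff.2 (DefP.congr (P := fun s => (∀ y, (∃ t, C t ∧ y = f t) → y ≤ s) ∧
    ∀ u, (∀ y, (∃ t, C t ∧ y = f t) → y ≤ u) → s ≤ u) inferInstance fun t => ?_),
    hs1 _ ⟨x, hx, rfl⟩, hs2 _ (by rintro _ ⟨t, ht, rfl⟩; exact hfg t x ht hx)⟩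
  exact ⟨fun h => le_antisymm (h.2 s hs1) (hs2 t h.1), fun h => h ▸ ⟨hs1, hs2⟩⟩

variable [TopologicalSpace K] [OrderTopology K] {E : L.ElementarySubstructure K} {x : K}
  {δ : K → K}

/-- If `δ u ≤ 0 ≤ δ v` then some element of the base model lies between `u` and `v`: these are
values at `x` of an antitone and a monotone definable function on an interval with endpoints
in the base model. -/
theorem IsTDerivation.exists_mem_between (hK : Tame L K) (hx : IsSimpleExtension E x)
    (hδ : IsTDerivation L δ) (hE : IsLinearOver (E : Set K) δ) (hδx : δ x = 1) {u v : K}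
    (hu : δ u ≤ 0) (hv : 0 ≤ δ v) : ∃ e ∈ E, min u v ≤ e ∧ e ≤ max u v := by
  obtain ⟨G, hG, rfl, hGd⟩ := hδ.exists_hasD hK hx hE hδx u
  obtain ⟨H, hH, rfl, hHd⟩ := hδ.exists_hasD hK hx hE hδx v
  have hG' := hG.mono (subset_univ _)
  have hH' := hH.mono (subset_univ _)
  let P : K → Prop := fun t => (∃ d, d ≤ 0 ∧ HasD G t d) ∧ (∃ d, 0 ≤ d ∧ HasD H t d) ∧
    (G t ≤ H t ↔ G x ≤ H x)
  have hPdef : DefP L (E : Set K) P := inferInstance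
  obtain ⟨C, hC, hCx, hCP, hconv⟩ := hK.exists_convex hx.notMem_dcl P
    ⟨⟨_, hu, hGd⟩, ⟨_, hv, hHd⟩, Iff.rfl⟩
  have hGanti : ∀ s t, C s → C t → s ≤ t → G t ≤ G s := fun s t hs ht hst => by
    have := hK.le_of_hasD_nonneg (fun t => - G t) hst fun r h1 h2 => by
      obtain ⟨d, hd, hGd⟩ := (hCP r (hconv s t r hs ht h1 h2)).1
      exact ⟨-d, neg_nonneg.2 hd, hGd.neg⟩
    exact neg_le_neg_iff.1 this
  have hHmono : ∀ s t, C s → C t → s ≤ t → H s ≤ H t := fun s t hs ht hst =>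
    hK.le_of_hasD_nonneg H hst fun r h1 h2 => (hCP r (hconv s t r hs ht h1 h2)).2.1
  rcases le_or_gt (G x) (H x) with h | h
  · have hGH : ∀ t, C t → G t ≤ H t := fun t ht => (hCP t ht).2.2.2 h
    obtain ⟨s, hs, h1, h2⟩ := hK.exists_mem_dcl_between (A := (E : Set K)) G H C hCx
      fun t t' ht ht' => by
        rcases le_total t t' with htt | htt
        · exact (hGH t ht).trans (hHmono t t' ht ht' htt)
        · exact (hGanti t' t ht' ht htt).trans (hGH t' ht')
    exact ⟨s, mem_of_mem_dcl E hs, (min_le_left _ _).trans h1, h2.trans (le_max_right _ _)⟩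
  · have hGH : ∀ t, C t → H t ≤ G t := fun t ht =>
      (not_le.1 fun h' => h.not_ge ((hCP t ht).2.2.1 h')).le
    obtain ⟨s, hs, h1, h2⟩ := hK.exists_mem_dcl_between (A := (E : Set K)) H G C hCx
      fun t t' ht ht' => by
        rcases le_total t t' with htt | htt
        · exact (hHmono t t' ht ht' htt).trans (hGH t' ht')
        · exact (hGH t ht).trans (hGanti t' t ht' ht htt)
    exact ⟨s, mem_of_mem_dcl E hs, (min_le_right _ _).trans h1, h2.trans (le_max_left _ _)⟩

/-- If `δ s ≤ δ a ≤ δ t` then `δ` takes the value `δ a` between `s` and `t`, at a translate of `a` by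
an element of the base model. -/
theorem IsTDerivation.exists_eq_between (hK : Tame L K) (hx : IsSimpleExtension E x)
    (hδ : IsTDerivation L δ) (hE : IsLinearOver (E : Set K) δ) (hδx : δ x = 1) {s a t : K}
    (hs : δ s ≤ δ a) (ht : δ a ≤ δ t) : ∃ c, min s t ≤ c ∧ c ≤ max s t ∧ δ c = δ a := by
  have hsub : ∀ b, δ (b - a) = δ b - δ a := fun b => by
    have := hE.1 (b - a) a
    rw [sub_add_cancel] at this
    rw [this, add_sub_cancel_right]
  obtain ⟨e, he, h1, h2⟩ := hδ.exists_mem_between hK hx hE hδx (u := s - a) (v := t - a)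
    (by rw [hsub]; linarith) (by rw [hsub]; linarith)
  rw [min_sub_sub_right] at h1
  rw [max_sub_sub_right] at h2
  exact ⟨e + a, by linarith, by linarith, by
    rw [hE.1, hδ.eq_zero_of_mem hE he, zero_add]⟩

theorem IsTDerivation.isConvexFor (hK : Tame L K) (hx : IsSimpleExtension E x)
    (hδ : IsTDerivation L δ) (hE : IsLinearOver (E : Set K) δ) (hδx : δ x = 1) (S : Set K)
    (hS : S.OrdConnected) : IsConvexFor δ S := by
  rintro a ha ⟨_, ⟨s, hs, rfl⟩, _, ⟨t, ht, rfl⟩, h1, h2⟩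
  obtain ⟨c, h3, h4, h5⟩ := hδ.exists_eq_between hK hx hE hδx h1 h2
  exact ha ⟨c, hS.uIcc_subset hs ht ⟨h3, h4⟩, h5⟩

end Between

/-! ### Exponentials and logarithmic derivatives -/

section Exponential

variable {L : FirstOrder.Language.{u, v}} {K : Type w} [L.Structure K]
  [OrderedRingLanguage L] [Field K] [LinearOrder K] [IsStrictOrderedRing K]
  [OrderedFieldExpansion L K]

theorem DefinesExponential.exists_defF {φ : L.Formula (Fin 2)} (h : DefinesExponential φ K) :
    ∃ e : K → K, DefF L (∅ : Set K) e ∧ StrictMono e ∧ (∀ a b, e (a + b) = e a * e b) ∧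
      range e = Ioi 0 := by
  obtain ⟨e, he, h1⟩ := h
  have h2 : DefP L (∅ : Set K) (fun v : Fin 2 → K => φ.Realize v) :=
    ⟨empty_definable_iff.2 ⟨φ, rfl⟩⟩
  have h3 : DefF L (∅ : Set K) (fun z : K × K => ![z.1, z.2]) :=
    DefF.pi (Fin.forall_fin_two.2 ⟨DefF.fst, DefF.snd⟩)
  exact ⟨e, DefF.of_graph (P := fun a b => φ.Realize ![a, b]) (h2.comp h3) he, h1⟩

/-- A definable exponential solves `e' = l e`: it is differentiable somewhere by o-minimality,
hence everywhere by the functional equation. -/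
theorem Tame.exists_hasD_exponential (hK : Tame L K) (e : K → K) [he : DefF L (univ : Set K) e]
    (hmono : StrictMono e) (hadd : ∀ a b, e (a + b) = e a * e b) (hpos : ∀ a, 0 < e a) :
    ∃ l, 0 < l ∧ ∀ t, HasD e t (l * e t) := by
  obtain ⟨t0, d, _, _, hd⟩ := hK.exists_hasD e (zero_lt_one (α := K))
  -- `e s - e t = e (t - t0) * (e (s - t + t0) - e t0)`
  have key : ∀ t, HasD e t (d / e t0 * e t) := by
    intro t ε hε
    have hc : e t = e (t - t0) * e t0 := by rw [← hadd, sub_add_cancel]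
    obtain ⟨r, hr, h1⟩ := hd (ε / e (t - t0)) (div_pos hε (hpos _))
    refine ⟨r, hr, fun s hs => ?_⟩
    have h2 := h1 (s - t + t0) (by simpa using hs)
    have h3 : e s = e (t - t0) * e (s - t + t0) := by rw [← hadd]; congr 1; ring
    have h4 : e s - e t - d / e t0 * e t * (s - t) =
        e (t - t0) * (e (s - t + t0) - e t0 - d * (s - t + t0 - t0)) := by
      have := (hpos t0).ne'
      rw [h3, hc]
      field_simp
      ring
    rw [h4, abs_mul, abs_of_pos (hpos _)]
    refine (mul_le_mul_of_nonneg_left h2 (hpos _).le).trans_eq ?_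
    have := (hpos (t - t0)).ne'
    rw [add_sub_cancel_right]
    field_simp
  refine ⟨d / e t0, ?_, key⟩
  -- for `l ≤ 0` the function `e` would be antitone
  by_contra hl
  have := hK.le_of_hasD_nonneg (fun t => - e t) (zero_le_one (α := K)) fun t _ _ =>
    ⟨_, neg_nonneg.2 (mul_nonpos_of_nonpos_of_nonneg (not_lt.1 hl) (hpos t).le), (key t).neg⟩
  exact absurd (hmono (zero_lt_one (α := K))) (not_lt.2 (neg_le_neg_iff.1 this))

variable [TopologicalSpace K] [OrderTopology K] {δ : K → K}

/-- The chain rule for `e`, as a function on `K ^ 1`. -/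
theorem IsTDerivation.apply_exponential (hδ : IsTDerivation L δ) (e : K → K)
    [he : DefF L (∅ : Set K) e] {l : K} (hl : 0 < l) (hd : ∀ t, HasD e t (l * e t)) (a : K) :
    δ (e a) = l * e a * δ a := by
  have hp : ∀ p : Fin 1 → K, HasD (fun t => e (Function.update p 0 t 0)) (p 0) (l * e (p 0)) :=
    fun p => by simpa using hd (p 0)
  have hpd : ∀ p : Fin 1 → K, pderiv (fun p : Fin 1 → K => e (p 0)) 0 p = l * e (p 0) :=
    fun p => the_eq (hp p) fun d' hd' => hd'.unique (hp p)
  have hnear : ∀ p : Fin 1 → K, IsC1At (fun p : Fin 1 → K => e (p 0)) p := by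
    intro p i
    obtain rfl : i = 0 := Subsingleton.elim _ _
    refine ⟨hpd p ▸ hp p, fun ε hε => ?_⟩
    obtain ⟨r, hr, h1⟩ := (hd (p 0)).contAt (ε / l) (div_pos hε hl)
    refine ⟨r, hr, fun q hq => ?_⟩
    change |pderiv (fun p : Fin 1 → K => e (p 0)) 0 q -
      pderiv (fun p : Fin 1 → K => e (p 0)) 0 p| < ε
    rw [hpd, hpd, ← mul_sub, abs_mul, abs_of_pos hl, mul_comm, ← lt_div_iff₀ hl]
    exact h1 _ (hq 0)
  have := hδ.eq_sum (a := fun _ : Fin 1 => a) (F := fun p : Fin 1 → K => e (p 0))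
    ⟨1, one_pos, fun q _ => hnear q⟩
  simpa [hpd] using this

variable {E : L.ElementarySubstructure K} {x : K}

/-- Logarithms reduce the statement about `logDer δ` on positive elements to that about `δ`. -/
theorem IsTDerivation.exists_logDer_eq_between (hK : Tame L K) (hx : IsSimpleExtension E x)
    (hδ : IsTDerivation L δ) (hE : IsLinearOver (E : Set K) δ) (hδx : δ x = 1)
    {φ : L.Formula (Fin 2)} (hφ : DefinesExponential φ K) {s a t : K} (hs0 : 0 < s) (ht0 : 0 < t)
    (ha0 : a ≠ 0) (hs : δ s / s ≤ δ a / a) (ht : δ a / a ≤ δ t / t) :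
    ∃ c, min s t ≤ c ∧ c ≤ max s t ∧ δ c / c = δ a / a := by
  obtain ⟨e, he, hmono, hadd, hrange⟩ := hφ.exists_defF
  have hpos : ∀ b, 0 < e b := fun b => hrange.subset (mem_range_self b)
  have he' := he.mono (subset_univ _)
  obtain ⟨l, hl, hd⟩ := hK.exists_hasD_exponential e hmono hadd hpos
  have hlog : ∀ b, δ (e b) / e b = l * δ b := fun b => by
    have := (hpos b).ne'
    rw [hδ.apply_exponential e hl hd]
    field_simp
  obtain ⟨σ, rfl⟩ := hrange.superset hs0
  obtain ⟨τ, rfl⟩ := hrange.superset ht0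
  obtain ⟨α, hα⟩ : ∃ α, δ a / a = l * δ α := by
    rcases lt_or_gt_of_ne ha0 with h | h
    · obtain ⟨α, hα⟩ := hrange.superset (neg_pos.2 h)
      have hneg : δ (-a) = - δ a := by
        have h0 : δ 0 = 0 := by simpa using hE.1 0 0
        have := hE.1 (-a) a
        rw [neg_add_cancel, h0] at this
        linear_combination -this
      refine ⟨α, ?_⟩
      rw [← hlog, hα, hneg, neg_div_neg_eq]
    · obtain ⟨α, rfl⟩ := hrange.superset h
      exact ⟨α, hlog α⟩
  rw [hα, hlog] at hs ht
  obtain ⟨c, h1, h2, h3⟩ := hδ.exists_eq_between hK hx hE hδx (le_of_mul_le_mul_left hs hl)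
    (le_of_mul_le_mul_left ht hl)
  refine ⟨e c, ?_, ?_, by rw [hlog, hα, h3]⟩
  · rw [← hmono.monotone.map_min]
    exact hmono.monotone h1
  · rw [← hmono.monotone.map_max]
    exact hmono.monotone h2

theorem IsTDerivation.isConvexFor_logDer (hK : Tame L K) (hx : IsSimpleExtension E x)
    (hδ : IsTDerivation L δ) (hE : IsLinearOver (E : Set K) δ) (hδx : δ x = 1)
    {φ : L.Formula (Fin 2)} (hφ : DefinesExponential φ K) {y : K} (hy : y ≠ 0) :
    IsConvexFor (logDer δ) (intervalNe (1 / y) y) := by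
  rintro ⟨a, ha0⟩ ha ⟨_, ⟨⟨s, hs0⟩, hs, rfl⟩, _, ⟨⟨t, ht0⟩, ht, rfl⟩, h1, h2⟩
  have hneg : ∀ b, δ (-b) / -b = δ b / b := fun b => by
    have h0 : δ 0 = 0 := by simpa using hE.1 0 0
    have := hE.1 (-b) b
    rw [neg_add_cancel, h0] at this
    rw [← neg_div_neg_eq, neg_neg, show δ b = - δ (-b) by linear_combination -this]
  have hsI : s ∈ Icc (1 / y) y := hs
  have htI : t ∈ Icc (1 / y) y := ht
  simp only [logDer] at h1 h2
  obtain ⟨c, hc0, hcI, hc⟩ : ∃ c, c ≠ 0 ∧ c ∈ Icc (1 / y) y ∧ δ c / c = δ a / a := by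
    rcases lt_or_gt_of_ne hy with hy | hy
    · have hs0 := neg_pos.2 (hsI.2.trans_lt hy)
      have ht0 := neg_pos.2 (htI.2.trans_lt hy)
      obtain ⟨c, h3, h4, h5⟩ := hδ.exists_logDer_eq_between hK hx hE hδx hφ hs0 ht0 ha0
        (by rwa [hneg]) (by rwa [hneg])
      have hc : -c ∈ Icc (1 / y) y := by
        rw [min_neg_neg] at h3
        rw [max_neg_neg] at h4
        refine ordConnected_Icc.uIcc_subset hsI htI ⟨?_, ?_⟩
        · linarith
        · linarith
      exact ⟨-c, (hc.2.trans_lt hy).ne, hc, by rw [hneg, h5]⟩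
    · have hy' := one_div_pos.2 hy
      obtain ⟨c, h3, h4, h5⟩ := hδ.exists_logDer_eq_between hK hx hE hδx hφ
        (hy'.trans_le hsI.1) (hy'.trans_le htI.1) ha0 h1 h2
      have hc : c ∈ Icc (1 / y) y := ordConnected_Icc.uIcc_subset hsI htI ⟨h3, h4⟩
      exact ⟨c, (hy'.trans_le hc.1).ne', hc, h5⟩
  exact ha ⟨⟨c, hc0⟩, hcI, hc⟩

end Exponential

/-! ### Convexity of the derivation and of the logarithmic derivative -/

/-- All models of an o-minimal field theory are `Tame`, being elementarily equivalent to an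
o-minimal one. -/
theorem IsOMinimalFieldTheory.tame {L : FirstOrder.Language.{u, v}} [OrderedRingLanguage L]
    {T : L.Theory} (hT : IsOMinimalFieldTheory.{u, v, w'} T) {K : Type w} [Field K] [LinearOrder K]
    [IsStrictOrderedRing K] [L.Structure K] [OrderedFieldExpansion L K] (hK : K ⊨ T) :
    Tame L K := by
  obtain ⟨hc, M, _, _, _, _, _, hM, homin⟩ := hT
  refine homin.tame.transfer fun φ => ?_
  rw [hc.realize_sentence_iff φ M, hc.realize_sentence_iff φ K]

end OMin

theorem mainTheorem7 {L : FirstOrder.Language.{u, v}} [OMin.OrderedRingLanguage L] (T : L.Theory)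
    (hT : OMin.IsOMinimalFieldTheory.{u, v, w'} T) (hexp : OMin.IsExponentialTheory.{u, v, w} T)
    {K : Type w} [Field K] [LinearOrder K] [IsStrictOrderedRing K]
    [TopologicalSpace K] [OrderTopology K]
    [L.Structure K] [OMin.OrderedFieldExpansion L K] (hK : K ⊨ T)
    (E : L.ElementarySubstructure K) (x : K) (hx : OMin.IsSimpleExtension E x)
    (δ : K → K) (hδ : OMin.IsTDerivation L δ) (hE : OMin.IsLinearOver (E : Set K) δ)
    (hδx : δ x = 1) :
    (∀ y : K, y ≠ 0 → OMin.IsConvexFor δ (Icc (-y) y)) ∧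
      (∀ y : K, y ≠ 0 → OMin.IsConvexFor (OMin.logDer δ) (OMin.intervalNe (1 / y) y)) ∧
      OMin.IsOrderLiouvilleConvex δ := by
  have htame : OMin.Tame L K := hT.tame hK
  obtain ⟨φ, hφ⟩ := hexp
  have h1 : ∀ y : K, OMin.IsConvexFor δ (Icc (-y) y) := fun y =>
    hδ.isConvexFor htame hx hE hδx _ ordConnected_Icc
  have h2 : ∀ y : K, y ≠ 0 → OMin.IsConvexFor (OMin.logDer δ) (OMin.intervalNe (1 / y) y) :=
    fun y hy => hδ.isConvexFor_logDer htame hx hE hδx (hφ K hK) hy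
  exact ⟨fun y _ => h1 y, h2, fun y _ => h1 y, fun y hy => h2 y (one_pos.trans_le hy).ne'⟩
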